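/- **Theorem.** There is a universal constant $C>0$ with the following property. Let $a(n)\neq 0$ and $b(n)$ $(n\in\mathbb Z)$ be real numbers with $\sum_{n\ge 1}|a(n)|^{-1}=\sum_{n\ge1}|a(-n)|^{-1}=\infty$, and let $H$ be the (self-adjoint) operator on $\ell^2(\mathbb Z)$ given by $$(Hu)(n)=a(n)u(n+1)+a(n-1)u(n-1)+b(n)u(n)$$ on its maximal domain $\{u\in\ell^2(\mathbb Z): Hu\in\ell^2(\mathbb Z)\}$. Let $\mu$ be the spectral measure of $\delta_1$, i.e. $\langle (H-z)^{-1}\delta_1,\delta_1\rangle=\int_{\mathbb R}\frac{d\mu(x)}{x-z}$ for $z\in\mathbb C\setminus\mathbb R$, and write $\langle A(t)\rangle_T=\frac2T\int_0^\infty e^{-2t/T}A(t)\,dt$ and $$\|\phi\|_{L_1,L_2}^2=\sum_{n=-\lfloor L_1\rfloor}^{\lfloor L_2\rfloor}|\phi(n)|^2+(L_1-\lfloor L_1\rfloor)|\phi(-\lfloor L_1\rfloor-1)|^2+(L_2-\lfloor L_2\rfloor)|\phi(\lfloor L_2\rfloor+1)|^2 .$$ Then for all $T>0$ and $L_1,L_2>1$,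 $$\big\langle\|e^{-iHt}\delta_1\|_{L_1,L_2}^2\big\rangle_T> C\,\mu\big(\{E: L^-_{T^{-1}}(E)\le L_1\text{ and }L^+_{T^{-1}}(E)\le L_2\}\big),$$ and if $L_1,L_2>2$, then also $$\big\langle\|e^{-iHt}\delta_1\|_{L_1,L_2}^2\big\rangle_T> C\,\mu\big(\{E: \tilde L^-_{T^{-1}}(E)\le L_1\text{ and }\tilde L^+_{T^{-1}}(E)\le L_2\}\big).$$ Here the length scales are defined as follows. Let $\hat a(0)=1$ and $\hat a(n)=a(n)$ for $n\ne0$. For $E,\theta\in\mathbb R$ let $u_\theta(\cdot,E)$ be the solution on $\mathbb Z$ of $$\hat a(n)u(n+1)+\hat a(n-1)u(n-1)+b(n)u(n)=Eu(n),\qquad u_\theta(0,E)=\sin\theta,\quad u_\theta(1,E)=\cos\theta .$$ For $L\ge 0$ put $$\|\phi\|_{L,+}^2=\sum_{n=1}^{\lfloor L\rfloor}|\phi(n)|^2+(L-\lfloor L\rfloor)|\phi(\lfloor L\rfloor+1)|^2,\qquad \|\phi\|_{L,-}^2=\sum_{n=-\lfloor L\rfloor}^{0}|\phi(n)|^2+(L-\lfloor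 L\rfloor)|\phi(-\lfloor L\rfloor-1)|^2 .$$ For $\varepsilon>0$, $L^\pm_\varepsilon(E)$ is the unique $L\ge 0$ with $$\max_\theta\|u_\theta(\cdot,E)\|_{L,\pm}\cdot\min_\theta\|u_\theta(\cdot,E)\|_{L,\pm}=\varepsilon^{-1}.$$ Let $\Phi(n,E)=\begin{pmatrix}u_0(n+1,E)&u_{\pi/2}(n+1,E)\\u_0(n,E)&u_{\pi/2}(n,E)\end{pmatrix}$, let $\|\cdot\|$ be the Euclidean operator norm, and put $$\|\Phi(E)\|_{L,+}^2=\sum_{n=1}^{\lfloor L\rfloor-1}\|\Phi(n,E)\|^2+(L-\lfloor L\rfloor)\|\Phi(\lfloor L\rfloor,E)\|^2\quad(L\ge1),$$ $$\|\Phi(E)\|_{L,-}^2=\sum_{n=-\lfloor L\rfloor}^{-1}\|\Phi(n,E)\|^2+(L-\lfloor L\rfloor)\|\Phi(-\lfloor L\rfloor-1,E)\|^2\quad(L\ge0).$$ Then $\tilde L^+_\varepsilon(E)\ge 1$ and $\tilde L^-_\varepsilon(E)\ge 0$ are the unique numbers $L$ with, respectively, $$\|\Phi(E)\|_{L,+}=2\|\Phi(1,E)^{-1}\|\,\varepsilon^{-1},\qquad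 \|\Phi(E)\|_{L,-}=2\|\Phi(-1,E)^{-1}\|\,\varepsilon^{-1}.$$ -/

import Mathlib

open scoped lp

noncomputable section

namespace JacobiDyn

/-! ### The Jacobi operator on `ℓ²(ℤ)` -/

/-- The formal tridiagonal (Jacobi) expression
`(H u)(n) = a(n) u(n+1) + a(n-1) u(n-1) + b(n) u(n)`. -/
def jacobiExpr (a b : ℤ → ℝ) (u : ℤ → ℂ) (n : ℤ) : ℂ :=
  (a n : ℂ) * u (n + 1) + (a (n - 1) : ℂ) * u (n - 1) + (b n : ℂ) * u n

theorem jacobiExpr_add (a b : ℤ → ℝ) (u v : ℤ → ℂ) :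
    jacobiExpr a b (u + v) = jacobiExpr a b u + jacobiExpr a b v := by
  funext n; simp [jacobiExpr]; ring

theorem jacobiExpr_smul (a b : ℤ → ℝ) (c : ℂ) (u : ℤ → ℂ) :
    jacobiExpr a b (c • u) = c • jacobiExpr a b u := by
  funext n; simp [jacobiExpr]; ring

/-- The standing assumptions on the coefficients: `a(n) ≠ 0` for every `n`, and the series
`∑ |a(n)|⁻¹` diverges at `+∞` and at `-∞`. -/
structure IsJacobiData (a : ℤ → ℝ) : Prop where
  ne_zero : ∀ n, a n ≠ 0
  diverges_right : ¬ Summable fun n : ℕ => |a ((n : ℤ) + 1)|⁻¹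
  diverges_left : ¬ Summable fun n : ℕ => |a (-((n : ℤ) + 1))|⁻¹

/-- The maximal domain: all `u ∈ ℓ²(ℤ)` such that `H u ∈ ℓ²(ℤ)`. -/
def jacobiDomain (a b : ℤ → ℝ) : Submodule ℂ ℓ²(ℤ, ℂ) where
  carrier := {u | Memℓp (jacobiExpr a b u) 2}
  zero_mem' := by
    have h : jacobiExpr a b ((0 : ℓ²(ℤ, ℂ)) : ℤ → ℂ) = 0 := by
      funext n; simp [jacobiExpr]
    change Memℓp (jacobiExpr a b ((0 : ℓ²(ℤ, ℂ)) : ℤ → ℂ)) 2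
    rw [h]
    exact zero_memℓp
  add_mem' := by
    intro u v hu hv
    change Memℓp (jacobiExpr a b ((u + v : ℓ²(ℤ, ℂ)) : ℤ → ℂ)) 2
    rw [lp.coeFn_add, jacobiExpr_add]
    exact Memℓp.add hu hv
  smul_mem' := by
    intro c u hu
    change Memℓp (jacobiExpr a b ((c • u : ℓ²(ℤ, ℂ)) : ℤ → ℂ)) 2
    rw [lp.coeFn_smul, jacobiExpr_smul]
    exact Memℓp.const_smul hu c

/-- The (in general unbounded) Jacobi operator `H` on `ℓ²(ℤ)` with its maximal domain. Under
`IsJacobiData a` it is self-adjoint. -/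
def jacobiOperator (a b : ℤ → ℝ) : ℓ²(ℤ, ℂ) →ₗ.[ℂ] ℓ²(ℤ, ℂ) where
  domain := jacobiDomain a b
  toFun :=
    { toFun := fun u => ⟨jacobiExpr a b (u : ℓ²(ℤ, ℂ)), u.2⟩
      map_add' := fun _ _ => Subtype.ext (jacobiExpr_add a b _ _)
      map_smul' := fun c _ => Subtype.ext (jacobiExpr_smul a b c _) }

/-- The unit vector `δ₁`. -/
def delta1 : ℓ²(ℤ, ℂ) := lp.single 2 (1 : ℤ) (1 : ℂ)

/-- `ψ(t) = e^{-iHt} ψ₀` for `ψ₀` in the domain of the self-adjoint operator `H`: the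
(unique) solution of `i ∂ₜ ψ = H ψ`, `ψ(0) = ψ₀`, the derivative being taken in norm. -/
def IsEvolution (H : ℓ²(ℤ, ℂ) →ₗ.[ℂ] ℓ²(ℤ, ℂ)) (ψ₀ : ℓ²(ℤ, ℂ)) (ψ : ℝ → ℓ²(ℤ, ℂ)) : Prop :=
  ψ 0 = ψ₀ ∧ ∀ t : ℝ, ∃ v : H.domain, (v : ℓ²(ℤ, ℂ)) = ψ t ∧
    HasDerivAt ψ ((-Complex.I) • H v) t

/-- `μ` is the spectral measure of the vector `φ` for the self-adjoint operator `H`: the (unique)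
finite Borel measure on `ℝ` with `⟨(H - z)⁻¹ φ, φ⟩ = ∫ dμ(x) / (x - z)` for all non-real `z`.
Here `g = (H - z)⁻¹ φ` is the unique vector of the domain with `H g - z g = φ`; Mathlib's
inner product is conjugate-linear in its first argument. -/
def IsSpectralMeasure (H : ℓ²(ℤ, ℂ) →ₗ.[ℂ] ℓ²(ℤ, ℂ)) (φ : ℓ²(ℤ, ℂ))
    (μ : MeasureTheory.Measure ℝ) : Prop :=
  MeasureTheory.IsFiniteMeasure μ ∧ ∀ z : ℂ, z.im ≠ 0 →
    ∃ g : H.domain, H g - z • (g : ℓ²(ℤ, ℂ)) = φ ∧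
      inner ℂ φ (g : ℓ²(ℤ, ℂ)) = ∫ x : ℝ, ((x : ℂ) - z)⁻¹ ∂μ

/-- The time average `⟨A⟩_T = (2/T) ∫₀^∞ e^{-2t/T} A(t) dt`. -/
def timeAverage (T : ℝ) (A : ℝ → ℝ) : ℝ :=
  (2 / T) * ∫ t in Set.Ioi (0 : ℝ), Real.exp (-2 * t / T) * A t

/-! ### Truncated norms -/

/-- `‖φ‖²_{L₁,L₂}`: the weight of `φ` in `[-L₁, L₂]`, interpolated linearly in `L₁`, `L₂`. -/
def boxNormSq (φ : ℤ → ℂ) (L₁ L₂ : ℝ) : ℝ :=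
  ∑ n ∈ Finset.Icc (-⌊L₁⌋) ⌊L₂⌋, ‖φ n‖ ^ 2
    + (L₁ - ⌊L₁⌋) * ‖φ (-⌊L₁⌋ - 1)‖ ^ 2 + (L₂ - ⌊L₂⌋) * ‖φ (⌊L₂⌋ + 1)‖ ^ 2

/-- `‖φ‖²_L` on the right half-line `1, 2, 3, …`. -/
def rightNormSq (φ : ℤ → ℝ) (L : ℝ) : ℝ :=
  ∑ n ∈ Finset.Icc 1 ⌊L⌋, φ n ^ 2 + (L - ⌊L⌋) * φ (⌊L⌋ + 1) ^ 2

/-- `‖φ‖²_L` on the left half-line `0, -1, -2, …`: the sum runs from `-⌊L⌋` up to `0`. -/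
def leftNormSq (φ : ℤ → ℝ) (L : ℝ) : ℝ :=
  ∑ n ∈ Finset.Icc (-⌊L⌋) 0, φ n ^ 2 + (L - ⌊L⌋) * φ (-⌊L⌋ - 1) ^ 2

/-! ### Solutions of the eigenvalue equation and transfer matrices -/

/-- For `n ≥ 0` the pair `(u(n), u(n+1))`, for the solution with
`u(0) = sin θ`, `u(1) = cos θ`. -/
def rightPair (a b : ℤ → ℝ) (E θ : ℝ) : ℕ → ℝ × ℝ
  | 0 => (Real.sin θ, Real.cos θ)
  | n + 1 =>
    let p := rightPair a b E θ n
    (p.2, ((E - b (n + 1)) * p.2 - a n * p.1) / a (n + 1))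

/-- For `n ≥ 0` the pair `(u(-n), u(-n+1))`, for the solution with
`u(0) = sin θ`, `u(1) = cos θ`. -/
def leftPair (a b : ℤ → ℝ) (E θ : ℝ) : ℕ → ℝ × ℝ
  | 0 => (Real.sin θ, Real.cos θ)
  | n + 1 =>
    let p := leftPair a b E θ n
    (((E - b (-n)) * p.1 - a (-n) * p.2) / a (-n - 1), p.1)

/-- The solution `u_θ(·, E)` of `a(n) u(n+1) + a(n-1) u(n-1) + b(n) u(n) = E u(n)` on `ℤ`
with `u_θ(0) = sin θ`, `u_θ(1) = cos θ`. -/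
def sol (a b : ℤ → ℝ) (E θ : ℝ) : ℤ → ℝ
  | Int.ofNat n => (rightPair a b E θ n).1
  | Int.negSucc n => (leftPair a b E θ (n + 1)).1

theorem sol_zero (a b : ℤ → ℝ) (E θ : ℝ) : sol a b E θ 0 = Real.sin θ := rfl

theorem sol_one (a b : ℤ → ℝ) (E θ : ℝ) : sol a b E θ 1 = Real.cos θ := rfl

theorem sol_equation (a b : ℤ → ℝ) (ha : ∀ n, a n ≠ 0) (E θ : ℝ) (n : ℤ) :
    a n * sol a b E θ (n + 1) + a (n - 1) * sol a b E θ (n - 1) + b n * sol a b E θ n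
      = E * sol a b E θ n := by
  have key : ∀ k : ℕ, sol a b E θ (k : ℤ) = (rightPair a b E θ k).1 := fun k => rfl
  have key2 : ∀ k : ℕ, (rightPair a b E θ k).2 = sol a b E θ ((k : ℤ) + 1) := fun k => rfl
  have keyl : ∀ k : ℕ, sol a b E θ (-(k : ℤ)) = (leftPair a b E θ k).1 := by
    intro k
    cases k with
    | zero => rfl
    | succ k => rfl
  have keyl2 : ∀ k : ℕ, (leftPair a b E θ k).2 = sol a b E θ (-(k : ℤ) + 1) := by
    intro k
    cases k with
    | zero => rfl
    | succ k =>
      have h : (-((k + 1 : ℕ) : ℤ) + 1) = -(k : ℤ) := by push_cast; ring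
      rw [h, keyl]; rfl
  rcases lt_or_ge 0 n with h | h
  · obtain ⟨k, rfl⟩ : ∃ k : ℕ, n = k + 1 := ⟨(n - 1).toNat, by omega⟩
    have e : sol a b E θ ((k : ℤ) + 1 + 1)
        = ((E - b (k + 1)) * sol a b E θ ((k : ℤ) + 1) - a k * sol a b E θ k) / a (k + 1) := by
      rw [← key2, key]
      have : ((k : ℤ) + 1 + 1) = ((k + 2 : ℕ) : ℤ) := by push_cast; ring
      rw [this, key]
      rfl
    have hk := ha ((k : ℤ) + 1)
    rw [e, add_sub_cancel_right]
    field_simp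
    ring
  · obtain ⟨k, rfl⟩ : ∃ k : ℕ, n = -(k : ℤ) := ⟨(-n).toNat, by omega⟩
    have e : sol a b E θ (-(k : ℤ) - 1)
        = ((E - b (-k)) * sol a b E θ (-(k : ℤ)) - a (-k) * sol a b E θ (-(k : ℤ) + 1))
            / a (-k - 1) := by
      rw [← keyl2, keyl]
      have : (-(k : ℤ) - 1) = -((k + 1 : ℕ) : ℤ) := by push_cast; ring
      rw [this, keyl]
      simp only [leftPair]
      push_cast
      ring_nf
    have hk := ha (-(k : ℤ) - 1)
    rw [e]
    field_simp
    ring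

/-- The transfer matrix from site `0` to site `n`,
`Φ(n, E) = (u₀(n+1) u_{π/2}(n+1); u₀(n) u_{π/2}(n))`. -/
def transfer (a b : ℤ → ℝ) (E : ℝ) (n : ℤ) : Matrix (Fin 2) (Fin 2) ℝ :=
  !![sol a b E 0 (n + 1), sol a b E (Real.pi / 2) (n + 1);
     sol a b E 0 n, sol a b E (Real.pi / 2) n]

/-- The operator norm of a `2 × 2` matrix with respect to the Euclidean norm. -/
def opNorm (M : Matrix (Fin 2) (Fin 2) ℝ) : ℝ :=
  ‖Matrix.toEuclideanCLM (n := Fin 2) (𝕜 := ℝ) M‖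

/-- `‖Φ(E)‖²_L` on the right half-line; the matrices in it involve the sites `1, …, ⌊L⌋`, and
`⌊L⌋ + 1` in the last term. -/
def rightTransferSq (a b : ℤ → ℝ) (E L : ℝ) : ℝ :=
  ∑ n ∈ Finset.Icc 1 (⌊L⌋ - 1), opNorm (transfer a b E n) ^ 2
    + (L - ⌊L⌋) * opNorm (transfer a b E ⌊L⌋) ^ 2

/-- `‖Φ(E)‖²_L` on the left half-line; the matrices in it involve the sites `-⌊L⌋, …, 0`, and
`-⌊L⌋ - 1` in the last term. -/
def leftTransferSq (a b : ℤ → ℝ) (E L : ℝ) : ℝ :=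
  ∑ n ∈ Finset.Icc (-⌊L⌋) (-1), opNorm (transfer a b E n) ^ 2
    + (L - ⌊L⌋) * opNorm (transfer a b E (-⌊L⌋ - 1)) ^ 2

/-! ### Characteristic length scales

The scales belong to the two half-line operators on `{1, 2, …}` and `{0, -1, …}`. These do not
involve `a(0)`, which enters the solutions `u_θ` only as a normalization; it is set to `1`. -/

/-- The coefficients `a` with `a(0)` replaced by `1`. -/
def normalized (a : ℤ → ℝ) : ℤ → ℝ := Function.update a 0 1

/-- The scale `L⁺_ε(E)`: the `L` at which
`max_θ ‖u_θ‖_L · min_θ ‖u_θ‖_L = ε⁻¹` on the right half-line. Under `IsJacobiData a` and for `ε > 0`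
there is exactly one such `L`, since the left side vanishes for `L ≤ 1` and then increases strictly
and continuously to infinity. -/
def scaleRight (a b : ℤ → ℝ) (ε E : ℝ) : ℝ :=
  sInf {L : ℝ | 0 ≤ L ∧
    (⨆ θ : ℝ, √(rightNormSq (sol (normalized a) b E θ) L)) *
      (⨅ θ : ℝ, √(rightNormSq (sol (normalized a) b E θ) L)) = ε⁻¹}

/-- The scale `L⁻_ε(E)`: the analogue of `L⁺_ε(E)` on the left half-line. -/
def scaleLeft (a b : ℤ → ℝ) (ε E : ℝ) : ℝ :=
  sInf {L : ℝ | 0 ≤ L ∧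
    (⨆ θ : ℝ, √(leftNormSq (sol (normalized a) b E θ) L)) *
      (⨅ θ : ℝ, √(leftNormSq (sol (normalized a) b E θ) L)) = ε⁻¹}

/-- The transfer matrix scale on the right half-line: the (unique) `L ≥ 1` with
`‖Φ(E)‖_L = 2 ‖Φ(1,E)⁻¹‖ ε⁻¹`. -/
def transferScaleRight (a b : ℤ → ℝ) (ε E : ℝ) : ℝ :=
  sInf {L : ℝ | 1 ≤ L ∧
    √(rightTransferSq (normalized a) b E L)
      = 2 * opNorm (transfer (normalized a) b E 1)⁻¹ * ε⁻¹}

/-- The transfer matrix scale on the left half-line: the (unique) `L ≥ 0` with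
`‖Φ(E)‖_L = 2 ‖Φ(-1,E)⁻¹‖ ε⁻¹`. -/
def transferScaleLeft (a b : ℤ → ℝ) (ε E : ℝ) : ℝ :=
  sInf {L : ℝ | 0 ≤ L ∧
    √(leftTransferSq (normalized a) b E L)
      = 2 * opNorm (transfer (normalized a) b E (-1))⁻¹ * ε⁻¹}

end JacobiDyn

end

noncomputable section

namespace JacobiDyn

open Finset

/-! ### Linearly interpolated partial sums -/

/-! Put ε = 1/T. The Laplace transform i ∫₀^∞ e^{izt} ψ(t) dt at z = E + iε is the resolvent vector
u = (H - z)⁻¹δ₁. Plancherel in t, applied site by site, therefore turns the time average into (πT)⁻¹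
times the integral over E of the box norm of u (`IsEvolution.integral_boxNormSq_laplace`), and the
task is to bound that norm from below near every energy E' of the given set.

Cut between the sites 0 and 1. On each half-line u, with an adjusted boundary value, is a solution W
of the recurrence at energy z. Compare it with the solution at a real energy E' with |E - E'| < ε
and the same two initial values. By variation of parameters the difference is z - E' times a kernel
built from two real solutions f, g of Wronskian one. If f, g are orthogonal on the box and ‖f‖‖g‖ =
ε⁻¹, this correction is at most a constant times ‖W‖, so the comparison solution αf + βg satisfies
‖αf + βg‖² ≤ 15‖W‖². Orthogonality and the inequality between arithmetic and geometric means give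
‖αf + βg‖² ≥ 2|α||β|ε⁻¹, and |α||β| dominates the flux Im(conj W(0) · W(1)); see
`partialSum_norm_sq_ge_of_orthogonal`.

The fluxes of the two half-lines add up to -Im u(1) (`le_boxNormSq`). Since u(1) is the Borel
transform of μ at z, Im u(1) is at least μ(E - ε, E + ε)/(2ε). Integrating over the ε-neighbourhood
of the set and using Fubini (`mul_measure_le_lintegral_ball`) recovers the measure of the set.

The scales enter only through the Gram determinant of two solutions: its square root is the product
of the maximal and minimal truncated norms (`iSup_mul_iInf_sqrt`). For the transfer matrix scales, a
large sum of squared norms makes the longer of two orthogonal solutions long, while ‖Φ(±1)⁻¹‖ keeps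
the shorter one from being too short on the first two sites (`gram_ge_of_transfer`). -/

/-- The weight of the `k`-th term in a partial sum of length `s`. -/
def cutoff (s : ℝ) (k : ℕ) : ℝ := max 0 (min 1 (s - k))

/-- The partial sum of length `s`, interpolated linearly in `s`. -/
def partialSum (s : ℝ) (c : ℕ → ℝ) : ℝ := ∑ k ∈ range ⌈s⌉₊, cutoff s k * c k

theorem cutoff_nonneg (s : ℝ) (k : ℕ) : 0 ≤ cutoff s k := le_max_left _ _

theorem cutoff_mono {s t : ℝ} (h : s ≤ t) (k : ℕ) : cutoff s k ≤ cutoff t k := by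
  unfold cutoff; gcongr

theorem cutoff_eq_zero {s : ℝ} {k : ℕ} (h : s ≤ k) : cutoff s k = 0 := by
  unfold cutoff
  exact max_eq_left ((min_le_right _ _).trans (by linarith))

theorem cutoff_eq_one {s : ℝ} {k : ℕ} (h : (k : ℝ) + 1 ≤ s) : cutoff s k = 1 := by
  unfold cutoff
  rw [min_eq_left (by linarith)]; norm_num

theorem cutoff_floor {s : ℝ} (hs : 0 ≤ s) : cutoff s ⌊s⌋₊ = s - ⌊s⌋₊ := by
  have h1 := Nat.floor_le hs
  have h2 := Nat.lt_floor_add_one s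
  unfold cutoff
  rw [min_eq_right (by linarith), max_eq_right (by linarith)]

theorem lt_of_cutoff_ne_zero {s : ℝ} {k : ℕ} (h : cutoff s k ≠ 0) : (k : ℝ) < s := by
  by_contra! h'
  exact h (cutoff_eq_zero h')

theorem partialSum_eq_sum_range {s : ℝ} {M : ℕ} (h : s ≤ M) (c : ℕ → ℝ) :
    partialSum s c = ∑ k ∈ range M, cutoff s k * c k := by
  refine sum_subset (fun k hk => ?_) (fun k _ hk => ?_)
  · rw [mem_range] at hk ⊢
    exact hk.trans_le (Nat.ceil_le.2 h)
  · rw [mem_range, not_lt, Nat.ceil_le] at hk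
    rw [cutoff_eq_zero hk, zero_mul]

theorem partialSum_eq_floor {s : ℝ} (hs : 0 ≤ s) (c : ℕ → ℝ) :
    partialSum s c = ∑ k ∈ range ⌊s⌋₊, c k + (s - ⌊s⌋₊) * c ⌊s⌋₊ := by
  rw [partialSum_eq_sum_range (M := ⌊s⌋₊ + 1) (by exact_mod_cast (Nat.lt_floor_add_one s).le),
    sum_range_succ, cutoff_floor hs]
  congr 1
  refine sum_congr rfl fun k hk => ?_
  rw [cutoff_eq_one, one_mul]
  have : ((k + 1 : ℕ) : ℝ) ≤ ⌊s⌋₊ := by exact_mod_cast mem_range.1 hk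
  push_cast at this
  exact this.trans (Nat.floor_le hs)

theorem partialSum_add (s : ℝ) (c d : ℕ → ℝ) :
    partialSum s (fun k => c k + d k) = partialSum s c + partialSum s d := by
  simp [partialSum, mul_add, sum_add_distrib]

theorem partialSum_mul_left (s r : ℝ) (c : ℕ → ℝ) :
    partialSum s (fun k => r * c k) = r * partialSum s c := by
  simp [partialSum, mul_sum, mul_left_comm]

theorem partialSum_le_partialSum {c d : ℕ → ℝ} (s : ℝ)
    (h : ∀ k : ℕ, cutoff s k ≠ 0 → c k ≤ d k) : partialSum s c ≤ partialSum s d := by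
  refine sum_le_sum fun k _ => ?_
  by_cases hk : cutoff s k = 0
  · simp [hk]
  · exact mul_le_mul_of_nonneg_left (h k hk) (cutoff_nonneg s k)

theorem partialSum_nonneg {c : ℕ → ℝ} (s : ℝ) (h : ∀ k, 0 ≤ c k) : 0 ≤ partialSum s c :=
  sum_nonneg fun k _ => mul_nonneg (cutoff_nonneg s k) (h k)

theorem partialSum_mono {s t : ℝ} (hst : s ≤ t) {c : ℕ → ℝ} (h : ∀ k, 0 ≤ c k) :
    partialSum s c ≤ partialSum t c := by
  rw [partialSum_eq_sum_range (hst.trans (Nat.le_ceil t)), partialSum]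
  exact sum_le_sum fun k _ => mul_le_mul_of_nonneg_right (cutoff_mono hst k) (h k)

theorem sum_range_le_partialSum {s : ℝ} {n : ℕ} (hn : (n : ℝ) ≤ s) {c : ℕ → ℝ}
    (h : ∀ k, 0 ≤ c k) : ∑ k ∈ range n, c k ≤ partialSum s c := by
  refine le_trans (le_of_eq ?_) (partialSum_mono hn h)
  rw [partialSum_eq_floor (Nat.cast_nonneg n)]
  simp

theorem sum_range_le_partialSum_of_cutoff_ne_zero {s : ℝ} {n : ℕ} (hn : cutoff s n ≠ 0)
    {c : ℕ → ℝ} (h : ∀ k, 0 ≤ c k) : ∑ k ∈ range n, c k ≤ partialSum s c :=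
  sum_range_le_partialSum (lt_of_cutoff_ne_zero hn).le h

theorem continuous_partialSum (c : ℕ → ℝ) : Continuous fun s => partialSum s c := by
  rw [continuous_iff_continuousAt]
  intro s
  obtain ⟨M, hM⟩ := exists_nat_gt s
  -- Near s the number of terms can be frozen at a single M, which leaves a finite sum of continuous
  -- functions.
  have hc : Continuous fun t => ∑ k ∈ range M, cutoff t k * c k := by
    unfold cutoff; fun_prop
  refine hc.continuousAt.congr ?_
  filter_upwards [Iio_mem_nhds hM] with t ht
  exact (partialSum_eq_sum_range (le_of_lt ht) c).symm

theorem partialSum_succ_le {s : ℝ} {c : ℕ → ℝ} (h : ∀ k, 0 ≤ c k) :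
    partialSum (s - 1) (fun k => c (k + 1)) ≤ partialSum s c := by
  obtain ⟨M, hM⟩ := exists_nat_gt s
  rw [partialSum_eq_sum_range (M := M) (by linarith),
    partialSum_eq_sum_range (M := M + 1) (by push_cast; linarith), sum_range_succ']
  have : ∀ k : ℕ, cutoff (s - 1) k = cutoff s (k + 1) := fun k => by
    unfold cutoff; push_cast; ring_nf
  simp only [this]
  have := mul_nonneg (cutoff_nonneg s 0) (h 0)
  linarith

/-! ### Solutions on a half-line -/

/-- `W` solves the three-term recurrence with coefficients `A`, `B` and spectral parameter `z`
at the sites `1, 2, 3, …`. -/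
def IsSolution {K : Type*} [CommRing K] (A B : ℕ → K) (z : K) (W : ℕ → K) : Prop :=
  ∀ n, A (n + 1) * W (n + 2) + A n * W n + B (n + 1) * W (n + 1) = z * W (n + 1)

/-- The Wronskian of two sequences. -/
def wronskian {K : Type*} [CommRing K] (A f g : ℕ → K) (n : ℕ) : K :=
  A n * (f (n + 1) * g n - f n * g (n + 1))

theorem IsSolution.wronskian_succ {K : Type*} [CommRing K] {A B f g : ℕ → K} {z w : K}
    (hf : IsSolution A B z f) (hg : IsSolution A B w g) (n : ℕ) :
    wronskian A f g (n + 1) = wronskian A f g n + (z - w) * (f (n + 1) * g (n + 1)) := by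
  have h1 := hf n
  have h2 := hg n
  simp only [wronskian]
  linear_combination g (n + 1) * h1 - f (n + 1) * h2

/-- The discrete Green identity at two energies; for z = w it is constancy of the Wronskian, and for
z ≠ w it drives the variation of parameters. -/
theorem IsSolution.wronskian_eq {K : Type*} [CommRing K] {A B f g : ℕ → K} {z w : K}
    (hf : IsSolution A B z f) (hg : IsSolution A B w g) (n : ℕ) :
    wronskian A f g n
      = wronskian A f g 0 + (z - w) * ∑ k ∈ range n, f (k + 1) * g (k + 1) := by
  induction n with
  | zero => simp
  | succ n ih => rw [hf.wronskian_succ hg, ih, sum_range_succ]; ring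

theorem IsSolution.linear_comb {K : Type*} [CommRing K] {A B f g : ℕ → K} {z : K}
    (hf : IsSolution A B z f) (hg : IsSolution A B z g) (c d : K) :
    IsSolution A B z fun n => c * f n + d * g n := fun n => by
  linear_combination c * hf n + d * hg n

theorem IsSolution.ofReal {A B f : ℕ → ℝ} {E : ℝ} (hf : IsSolution A B E f) :
    IsSolution (fun n => (A n : ℂ)) (fun n => (B n : ℂ)) (E : ℂ) fun n => (f n : ℂ) := fun n => by
  have := congrArg (fun x : ℝ => (x : ℂ)) (hf n)
  push_cast at this
  exact this

theorem norm_sq_sum_mul_le (W : ℕ → ℂ) (f : ℕ → ℝ) (n : ℕ) :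
    ‖∑ k ∈ range n, W (k + 1) * (f (k + 1) : ℂ)‖ ^ 2
      ≤ (∑ k ∈ range n, ‖W (k + 1)‖ ^ 2) * ∑ k ∈ range n, f (k + 1) ^ 2 := by
  have h1 : ‖∑ k ∈ range n, W (k + 1) * (f (k + 1) : ℂ)‖
      ≤ ∑ k ∈ range n, ‖W (k + 1)‖ * |f (k + 1)| := by
    refine (norm_sum_le _ _).trans (le_of_eq ?_)
    simp
  calc _ ≤ (∑ k ∈ range n, ‖W (k + 1)‖ * |f (k + 1)|) ^ 2 := by gcongr
    _ ≤ (∑ k ∈ range n, ‖W (k + 1)‖ ^ 2) * ∑ k ∈ range n, |f (k + 1)| ^ 2 :=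
        sum_mul_sq_le_sq_mul_sq _ _ _
    _ = _ := by simp

theorem norm_sub_add_sq_le (x y v : ℂ) :
    ‖x - y + v‖ ^ 2 ≤ 3 * (‖x‖ ^ 2 + ‖y‖ ^ 2 + ‖v‖ ^ 2) := by
  have h : ‖x - y + v‖ ≤ ‖x‖ + ‖y‖ + ‖v‖ :=
    (norm_add_le _ _).trans (add_le_add_left (norm_sub_le _ _) _)
  calc _ ≤ (‖x‖ + ‖y‖ + ‖v‖) ^ 2 := by gcongr
    _ ≤ _ := by nlinarith [sq_nonneg (‖x‖ - ‖y‖), sq_nonneg (‖x‖ - ‖v‖), sq_nonneg (‖y‖ - ‖v‖)]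

theorem wronskian_eq_one {A B f g : ℕ → ℝ} {E : ℝ} (hA : A 0 = 1) (hf : IsSolution A B E f)
    (hg : IsSolution A B E g) (hfg : f 1 * g 0 - f 0 * g 1 = 1) (n : ℕ) :
    A n * (f (n + 1) * g n - f n * g (n + 1)) = 1 := by
  have := hf.wronskian_eq hg n
  simp only [wronskian, hA, sub_self, zero_mul, add_zero, one_mul, zero_add, hfg] at this
  exact this

/-- A perturbative lower bound for a solution at complex energy `z`, in terms of an orthogonal
pair of solutions at a nearby real energy `E`. -/
theorem partialSum_norm_sq_ge_of_orthogonal {A B f g : ℕ → ℝ} {E ε s : ℝ} {z : ℂ} {W : ℕ → ℂ}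
    (hε : 0 < ε) (hA : A 0 = 1)
    (hf : IsSolution A B E f) (hg : IsSolution A B E g) (hfg : f 1 * g 0 - f 0 * g 1 = 1)
    (hW : IsSolution (fun n => (A n : ℂ)) (fun n => (B n : ℂ)) z W)
    (hz : ‖z - E‖ ^ 2 ≤ 2 * ε ^ 2)
    (horth : partialSum s (fun k => f (k + 1) * g (k + 1)) = 0)
    (hD : partialSum s (fun k => f (k + 1) ^ 2) * partialSum s (fun k => g (k + 1) ^ 2)
      = (ε⁻¹) ^ 2) :
    2 / 15 * ε⁻¹ * |((starRingEnd ℂ) (W 0) * W 1).im|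
      ≤ partialSum s fun k => ‖W (k + 1)‖ ^ 2 := by
  set F := partialSum s (fun k => f (k + 1) ^ 2) with hF
  set G := partialSum s (fun k => g (k + 1) ^ 2) with hG
  set w := partialSum s (fun k => ‖W (k + 1)‖ ^ 2) with hw
  have hF0 : 0 ≤ F := partialSum_nonneg s fun k => sq_nonneg _
  have hG0 : 0 ≤ G := partialSum_nonneg s fun k => sq_nonneg _
  have hw0 : 0 ≤ w := partialSum_nonneg s fun k => sq_nonneg _
  -- α and β are the coefficients for which αf + βg agrees with W at the sites 0 and 1.
  set α : ℂ := W 1 * g 0 - W 0 * g 1 with hα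
  set β : ℂ := f 1 * W 0 - f 0 * W 1 with hβ
  have hc1 : ∀ n, (A n : ℂ) * (W (n + 1) * g n - W n * g (n + 1))
      = α + (z - E) * ∑ k ∈ range n, W (k + 1) * (g (k + 1) : ℂ) := fun n => by
    have := hW.wronskian_eq hg.ofReal n
    simpa only [wronskian, hA, Complex.ofReal_one, one_mul, zero_add] using this
  have hc2 : ∀ n, (A n : ℂ) * (W (n + 1) * f n - W n * f (n + 1))
      = - β + (z - E) * ∑ k ∈ range n, W (k + 1) * (f (k + 1) : ℂ) := fun n => by
    have := hW.wronskian_eq hf.ofReal n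
    simp only [wronskian, hA, Complex.ofReal_one, one_mul, zero_add] at this
    rw [this, hβ]; ring
  -- Variation of parameters: eliminate W n from the two Green identities, using that the Wronskian
  -- of f and g is one.
  have hY : ∀ n, α * f (n + 1) + β * g (n + 1)
      = W (n + 1) - (z - E) * ((∑ k ∈ range n, W (k + 1) * (g (k + 1) : ℂ)) * f (n + 1))
        + (z - E) * ((∑ k ∈ range n, W (k + 1) * (f (k + 1) : ℂ)) * g (n + 1)) := fun n => by
    have h1 := hc1 n
    have h2 := hc2 n
    have h3 : (A n : ℂ) * (f (n + 1) * g n - f n * g (n + 1)) = 1 := by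
      exact_mod_cast wronskian_eq_one hA hf hg hfg n
    linear_combination (-(f (n + 1) : ℂ)) * h1 + (g (n + 1) : ℂ) * h2 + W (n + 1) * h3
  have hbound : ∀ n : ℕ, cutoff s n ≠ 0 → ‖α * f (n + 1) + β * g (n + 1)‖ ^ 2
      ≤ 3 * ‖W (n + 1)‖ ^ 2 + (6 * ε ^ 2 * w * G) * f (n + 1) ^ 2
        + (6 * ε ^ 2 * w * F) * g (n + 1) ^ 2 := fun n hn => by
    -- Cauchy–Schwarz on the inner sum, which is then enlarged to the whole box; the factor 2ε²
    -- comes from the bound on |z - E|².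
    have key : ∀ (h : ℕ → ℝ) (y : ℝ),
        ‖(z - E) * ((∑ k ∈ range n, W (k + 1) * (h (k + 1) : ℂ)) * y)‖ ^ 2
          ≤ 2 * ε ^ 2 * (w * partialSum s fun k => h (k + 1) ^ 2) * y ^ 2 := fun h y => by
      rw [norm_mul, norm_mul, mul_pow, mul_pow, Complex.norm_real, Real.norm_eq_abs, sq_abs,
        ← mul_assoc]
      have h1 : ‖∑ k ∈ range n, W (k + 1) * (h (k + 1) : ℂ)‖ ^ 2
          ≤ w * partialSum s fun k => h (k + 1) ^ 2 := by
        refine (norm_sq_sum_mul_le W h n).trans ?_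
        refine mul_le_mul
          (sum_range_le_partialSum_of_cutoff_ne_zero (c := fun k => ‖W (k + 1)‖ ^ 2) hn
            fun k => sq_nonneg _)
          (sum_range_le_partialSum_of_cutoff_ne_zero (c := fun k => h (k + 1) ^ 2) hn
            fun k => sq_nonneg _)
          (sum_nonneg fun _ _ => sq_nonneg _) hw0
      gcongr
    rw [hY n]
    refine (norm_sub_add_sq_le _ _ _).trans ?_
    have k1 := key g (f (n + 1))
    have k2 := key f (g (n + 1))
    rw [← hG] at k1
    rw [← hF] at k2
    linarith
  have hup := partialSum_le_partialSum s hbound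
  rw [partialSum_add, partialSum_add, partialSum_mul_left, partialSum_mul_left,
    partialSum_mul_left, ← hw, ← hF, ← hG] at hup
  have hεD : ε ^ 2 * (F * G) = 1 := by rw [hD]; field_simp
  -- 15 = 3 + 6 + 6: summing the pointwise bound gives 3w + 12ε²FGw, and ε²FG = 1.
  have hup' : partialSum s (fun k => ‖α * f (k + 1) + β * g (k + 1)‖ ^ 2) ≤ 15 * w := by
    refine hup.trans (le_of_eq ?_)
    linear_combination 12 * w * hεD
  have hexp : ∀ k : ℕ, ‖α * f (k + 1) + β * g (k + 1)‖ ^ 2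
      = ‖α‖ ^ 2 * f (k + 1) ^ 2 + (2 * (α.re * β.re + α.im * β.im)) * (f (k + 1) * g (k + 1))
        + ‖β‖ ^ 2 * g (k + 1) ^ 2 := fun k => by
    rw [← Complex.normSq_eq_norm_sq, ← Complex.normSq_eq_norm_sq, ← Complex.normSq_eq_norm_sq]
    simp only [Complex.normSq_apply, Complex.add_re, Complex.add_im, Complex.mul_re,
      Complex.mul_im, Complex.ofReal_re, Complex.ofReal_im]
    ring
  simp only [hexp] at hup'
  rw [partialSum_add, partialSum_add, partialSum_mul_left, partialSum_mul_left,
    partialSum_mul_left, horth, ← hF, ← hG] at hup'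
  -- The flux is invariant under real changes of basis of determinant one, so it equals Im(conj β ·
  -- α).
  have him : |((starRingEnd ℂ) (W 0) * W 1).im| ≤ ‖α‖ * ‖β‖ := by
    have e : ((starRingEnd ℂ) (W 0) * W 1).im = ((starRingEnd ℂ) β * α).im := by
      rw [hα, hβ]
      simp only [Complex.mul_im, Complex.conj_re, Complex.conj_im, Complex.sub_re, Complex.sub_im,
        Complex.mul_re, Complex.ofReal_re, Complex.ofReal_im]
      linear_combination (-(W 0).im * (W 1).re + (W 0).re * (W 1).im) * (-hfg)
    rw [e]
    refine (Complex.abs_im_le_norm _).trans (le_of_eq ?_)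
    rw [norm_mul, RCLike.norm_conj, mul_comm]
  -- Arithmetic–geometric mean inequality with √F √G = ε⁻¹.
  have hgm : 2 * (‖α‖ * ‖β‖) * ε⁻¹ ≤ ‖α‖ ^ 2 * F + ‖β‖ ^ 2 * G := by
    have h1 : √F * √G = ε⁻¹ := by
      rw [← Real.sqrt_mul hF0, hD, Real.sqrt_sq (by positivity)]
    have h2 := sq_nonneg (‖α‖ * √F - ‖β‖ * √G)
    have h3 := Real.sq_sqrt hF0
    have h4 := Real.sq_sqrt hG0
    rw [← h1]
    nlinarith
  have hε' : 0 < ε⁻¹ := by positivity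
  have : |((starRingEnd ℂ) (W 0) * W 1).im| * ε⁻¹ ≤ ‖α‖ * ‖β‖ * ε⁻¹ := by gcongr
  linarith

/-! ### Gram determinants -/

/-- The Gram determinant of two sequences for the interpolated partial sum of length `s` over
the sites `1, 2, 3, …`. -/
def gram (f g : ℕ → ℝ) (s : ℝ) : ℝ :=
  partialSum s (fun k => f (k + 1) ^ 2) * partialSum s (fun k => g (k + 1) ^ 2)
    - partialSum s (fun k => f (k + 1) * g (k + 1)) ^ 2

theorem continuous_gram (f g : ℕ → ℝ) : Continuous (gram f g) := by
  unfold gram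
  have h1 := continuous_partialSum fun k => f (k + 1) ^ 2
  have h2 := continuous_partialSum fun k => g (k + 1) ^ 2
  have h3 := continuous_partialSum fun k => f (k + 1) * g (k + 1)
  fun_prop

/-- On at most one site the two sequences are proportional. -/
theorem gram_eq_zero {s : ℝ} (hs : s ≤ 1) (f g : ℕ → ℝ) : gram f g s = 0 := by
  unfold gram
  rw [partialSum_eq_sum_range (M := 1) (by simpa), partialSum_eq_sum_range (M := 1) (by simpa),
    partialSum_eq_sum_range (M := 1) (by simpa)]
  simp; ring

/-- Diagonalization of a real symmetric `2 × 2` matrix by a rotation. -/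
theorem exists_rotation (p q r : ℝ) : ∃ t : ℝ,
    (r - p) * (Real.cos t * Real.sin t) + q * (Real.cos t ^ 2 - Real.sin t ^ 2) = 0 ∧
    p * Real.cos t ^ 2 + 2 * q * (Real.cos t * Real.sin t) + r * Real.sin t ^ 2
      ≤ p * Real.sin t ^ 2 - 2 * q * (Real.cos t * Real.sin t) + r * Real.cos t ^ 2 := by
  -- The argument of ζ is twice the angle of the long principal axis; adding π before halving
  -- selects the short axis.
  set ζ : ℂ := ⟨(p - r) / 2, q⟩ with hζ
  refine ⟨(ζ.arg + Real.pi) / 2, ?_⟩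
  set t := (ζ.arg + Real.pi) / 2 with ht
  have h2 : 2 * t = ζ.arg + Real.pi := by rw [ht]; ring
  have c2 : Real.cos t ^ 2 - Real.sin t ^ 2 = - Real.cos ζ.arg := by
    rw [← Real.cos_two_mul', h2, Real.cos_add_pi]
  have s2 : 2 * (Real.cos t * Real.sin t) = - Real.sin ζ.arg := by
    have := Real.sin_two_mul t
    rw [h2, Real.sin_add_pi] at this
    linarith
  have hre : ‖ζ‖ * Real.cos ζ.arg = (p - r) / 2 := Complex.norm_mul_cos_arg ζ
  have him : ‖ζ‖ * Real.sin ζ.arg = q := Complex.norm_mul_sin_arg ζ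
  constructor
  · rw [c2]
    linear_combination (r - p) / 2 * s2 - Real.sin ζ.arg * hre + Real.cos ζ.arg * him
  · have h := Real.cos_sq_add_sin_sq ζ.arg
    have e : (p * Real.cos t ^ 2 + 2 * q * (Real.cos t * Real.sin t) + r * Real.sin t ^ 2)
        - (p * Real.sin t ^ 2 - 2 * q * (Real.cos t * Real.sin t) + r * Real.cos t ^ 2)
        = - 2 * ‖ζ‖ := by
      linear_combination (p - r) * c2 + 2 * q * s2 + 2 * Real.cos ζ.arg * hre
        + 2 * Real.sin ζ.arg * him - 2 * ‖ζ‖ * h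
    have := norm_nonneg ζ
    linarith

theorem partialSum_linear_comb_sq (f g : ℕ → ℝ) (s x y : ℝ) :
    partialSum s (fun k => (x * f (k + 1) + y * g (k + 1)) ^ 2)
      = partialSum s (fun k => f (k + 1) ^ 2) * x ^ 2
        + 2 * partialSum s (fun k => f (k + 1) * g (k + 1)) * (x * y)
        + partialSum s (fun k => g (k + 1) ^ 2) * y ^ 2 := by
  have : ∀ k : ℕ, (x * f (k + 1) + y * g (k + 1)) ^ 2
      = x ^ 2 * f (k + 1) ^ 2 + (2 * (x * y)) * (f (k + 1) * g (k + 1))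
        + y ^ 2 * g (k + 1) ^ 2 := fun k => by ring
  simp only [this]
  rw [partialSum_add, partialSum_add, partialSum_mul_left, partialSum_mul_left,
    partialSum_mul_left]
  ring

/-- A pair of sequences can be rotated into an orthogonal pair, the first of which is the
shorter one. -/
theorem exists_orthogonal_pair (f g : ℕ → ℝ) (s : ℝ) : ∃ t : ℝ,
    partialSum s (fun k => (Real.cos t * f (k + 1) + Real.sin t * g (k + 1))
      * (-Real.sin t * f (k + 1) + Real.cos t * g (k + 1))) = 0 ∧
    partialSum s (fun k => (Real.cos t * f (k + 1) + Real.sin t * g (k + 1)) ^ 2)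
      * partialSum s (fun k => (-Real.sin t * f (k + 1) + Real.cos t * g (k + 1)) ^ 2)
      = gram f g s ∧
    partialSum s (fun k => (Real.cos t * f (k + 1) + Real.sin t * g (k + 1)) ^ 2)
      + partialSum s (fun k => (-Real.sin t * f (k + 1) + Real.cos t * g (k + 1)) ^ 2)
      = partialSum s (fun k => f (k + 1) ^ 2) + partialSum s (fun k => g (k + 1) ^ 2) ∧
    partialSum s (fun k => (Real.cos t * f (k + 1) + Real.sin t * g (k + 1)) ^ 2)
      ≤ partialSum s (fun k => (-Real.sin t * f (k + 1) + Real.cos t * g (k + 1)) ^ 2) := by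
  obtain ⟨t, h1, h2⟩ := exists_rotation (partialSum s fun k => f (k + 1) ^ 2)
    (partialSum s fun k => f (k + 1) * g (k + 1)) (partialSum s fun k => g (k + 1) ^ 2)
  have hcs := Real.cos_sq_add_sin_sq t
  have horth : partialSum s (fun k => (Real.cos t * f (k + 1) + Real.sin t * g (k + 1))
      * (-Real.sin t * f (k + 1) + Real.cos t * g (k + 1))) = 0 := by
    have : ∀ k : ℕ, (Real.cos t * f (k + 1) + Real.sin t * g (k + 1))
        * (-Real.sin t * f (k + 1) + Real.cos t * g (k + 1))
        = (-(Real.cos t * Real.sin t)) * f (k + 1) ^ 2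
          + (Real.cos t ^ 2 - Real.sin t ^ 2) * (f (k + 1) * g (k + 1))
          + (Real.cos t * Real.sin t) * g (k + 1) ^ 2 := fun k => by ring
    simp only [this]
    rw [partialSum_add, partialSum_add, partialSum_mul_left, partialSum_mul_left,
      partialSum_mul_left]
    linear_combination h1
  refine ⟨t, horth, ?_, ?_, ?_⟩
  · rw [partialSum_linear_comb_sq, partialSum_linear_comb_sq, gram]
    set p := partialSum s fun k => f (k + 1) ^ 2
    set q := partialSum s fun k => f (k + 1) * g (k + 1)
    set r := partialSum s fun k => g (k + 1) ^ 2
    have e : ((r - p) * (Real.cos t * Real.sin t) + q * (Real.cos t ^ 2 - Real.sin t ^ 2)) ^ 2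
        = 0 := by rw [h1]; ring
    have hcs2 : (Real.cos t ^ 2 + Real.sin t ^ 2) ^ 2 = 1 := by rw [hcs]; ring
    linear_combination e + (p * r - q ^ 2) * hcs2
  · rw [partialSum_linear_comb_sq, partialSum_linear_comb_sq]
    linear_combination (partialSum s (fun k => f (k + 1) ^ 2)
      + partialSum s (fun k => g (k + 1) ^ 2)) * hcs
  · rw [partialSum_linear_comb_sq, partialSum_linear_comb_sq]
    linarith

/-- A rotation makes the pair orthogonal while preserving both its Wronskian and its Gram
determinant, so the Gram value alone suffices. The bound passes from s to s' because its right side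
grows with the box; no monotonicity of the Gram determinant is needed. -/
theorem partialSum_norm_sq_ge {A B f g : ℕ → ℝ} {E ε s s' : ℝ} {z : ℂ} {W : ℕ → ℂ}
    (hε : 0 < ε) (hA : A 0 = 1)
    (hf : IsSolution A B E f) (hg : IsSolution A B E g) (hfg : f 1 * g 0 - f 0 * g 1 = 1)
    (hW : IsSolution (fun n => (A n : ℂ)) (fun n => (B n : ℂ)) z W)
    (hz : ‖z - E‖ ^ 2 ≤ 2 * ε ^ 2) (hD : gram f g s = (ε⁻¹) ^ 2) (hs : s ≤ s') :
    2 / 15 * ε⁻¹ * |((starRingEnd ℂ) (W 0) * W 1).im|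
      ≤ partialSum s' fun k => ‖W (k + 1)‖ ^ 2 := by
  obtain ⟨t, h1, h2, -, -⟩ := exists_orthogonal_pair f g s
  refine le_trans ?_ (partialSum_mono hs fun k => sq_nonneg _)
  refine partialSum_norm_sq_ge_of_orthogonal
    (f := fun n => Real.cos t * f n + Real.sin t * g n)
    (g := fun n => -Real.sin t * f n + Real.cos t * g n) hε hA
    (hf.linear_comb hg _ _) (hf.linear_comb hg _ _) ?_ hW hz h1 (h2.trans hD)
  linear_combination (Real.cos t ^ 2 + Real.sin t ^ 2) * hfg + Real.cos_sq_add_sin_sq t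

/-- In the rotated orthogonal basis the squared norm is m cos² + M sin² with m ≤ M, so the extreme
values are √m and √M, and mM is the Gram determinant. -/
theorem iSup_mul_iInf_sqrt (f g : ℕ → ℝ) (s : ℝ) :
    (⨆ θ : ℝ, √(partialSum s fun k => (Real.cos θ * f (k + 1) + Real.sin θ * g (k + 1)) ^ 2))
      * (⨅ θ : ℝ, √(partialSum s fun k => (Real.cos θ * f (k + 1) + Real.sin θ * g (k + 1)) ^ 2))
      = √(gram f g s) := by
  obtain ⟨t, h1, h2, h3, h4⟩ := exists_orthogonal_pair f g s
  set u : ℕ → ℝ := fun k => Real.cos t * f k + Real.sin t * g k with hu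
  set v : ℕ → ℝ := fun k => -Real.sin t * f k + Real.cos t * g k with hv
  set m := partialSum s fun k => u (k + 1) ^ 2
  set M := partialSum s fun k => v (k + 1) ^ 2
  have hm : 0 ≤ m := partialSum_nonneg s fun k => sq_nonneg _
  have hQ : ∀ θ : ℝ, partialSum s (fun k => (Real.cos θ * f (k + 1) + Real.sin θ * g (k + 1)) ^ 2)
      = m * Real.cos (θ - t) ^ 2 + M * Real.sin (θ - t) ^ 2 := fun θ => by
    have e : ∀ k : ℕ, Real.cos θ * f (k + 1) + Real.sin θ * g (k + 1)
        = Real.cos (θ - t) * u (k + 1) + Real.sin (θ - t) * v (k + 1) := fun k => by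
      rw [hu, hv, Real.cos_sub, Real.sin_sub]
      have := Real.cos_sq_add_sin_sq t
      linear_combination (-(Real.cos θ * f (k + 1) + Real.sin θ * g (k + 1))) * this
    simp only [e]
    rw [partialSum_linear_comb_sq u v, h1]
    ring
  simp only [hQ]
  have hlow : ∀ θ, √m ≤ √(m * Real.cos (θ - t) ^ 2 + M * Real.sin (θ - t) ^ 2) := fun θ => by
    apply Real.sqrt_le_sqrt
    nlinarith [Real.cos_sq_add_sin_sq (θ - t), sq_nonneg (Real.sin (θ - t))]
  have hupp : ∀ θ, √(m * Real.cos (θ - t) ^ 2 + M * Real.sin (θ - t) ^ 2) ≤ √M := fun θ => by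
    apply Real.sqrt_le_sqrt
    nlinarith [Real.cos_sq_add_sin_sq (θ - t), sq_nonneg (Real.cos (θ - t))]
  have hsup : (⨆ θ : ℝ, √(m * Real.cos (θ - t) ^ 2 + M * Real.sin (θ - t) ^ 2)) = √M := by
    refine le_antisymm (ciSup_le hupp) ?_
    refine le_ciSup_of_le ⟨√M, by rintro _ ⟨θ, rfl⟩; exact hupp θ⟩ (t + Real.pi / 2) ?_
    simp
  have hinf : (⨅ θ : ℝ, √(m * Real.cos (θ - t) ^ 2 + M * Real.sin (θ - t) ^ 2)) = √m := by
    refine le_antisymm ?_ (le_ciInf hlow)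
    refine ciInf_le_of_le ⟨√m, by rintro _ ⟨θ, rfl⟩; exact hlow θ⟩ t ?_
    simp
  rw [hsup, hinf, ← Real.sqrt_mul (hm.trans h4), mul_comm M m, ← h2]

theorem gram_nonneg (f g : ℕ → ℝ) (s : ℝ) : 0 ≤ gram f g s := by
  obtain ⟨t, -, h2, -, -⟩ := exists_orthogonal_pair f g s
  rw [← h2]
  exact mul_nonneg (partialSum_nonneg s fun k => sq_nonneg _)
    (partialSum_nonneg s fun k => sq_nonneg _)

theorem abs_wronskian_inv {A B f g : ℕ → ℝ} {E : ℝ} (hA : A 0 = 1) (hf : IsSolution A B E f)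
    (hg : IsSolution A B E g) (hfg : f 1 * g 0 - f 0 * g 1 = 1) (n : ℕ) :
    |A n|⁻¹ = |f (n + 1) * g n - f n * g (n + 1)| := by
  have := wronskian_eq_one hA hf hg hfg n
  rw [← abs_inv, eq_inv_of_mul_eq_one_right this]

/-- Constancy of the Wronskian writes 1/|A| through products of neighbouring values. Cauchy–Schwarz
for the orthogonal pair then gives √m √M = √gram twice; an arbitrary pair would give only a product
of norms. Divergence of the series thus makes the Gram determinant unbounded. -/
theorem sum_abs_inv_le_gram {A B f g : ℕ → ℝ} {E : ℝ} (hA : A 0 = 1) (hf : IsSolution A B E f)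
    (hg : IsSolution A B E g) (hfg : f 1 * g 0 - f 0 * g 1 = 1) (n : ℕ) :
    ∑ k ∈ range n, |A (k + 1)|⁻¹ ≤ 2 * √(gram f g (n + 1)) := by
  obtain ⟨t, -, h2, -, -⟩ := exists_orthogonal_pair f g ((n : ℝ) + 1)
  set u : ℕ → ℝ := fun k => Real.cos t * f k + Real.sin t * g k with hu
  set v : ℕ → ℝ := fun k => -Real.sin t * f k + Real.cos t * g k with hv
  have hus : IsSolution A B E u := hf.linear_comb hg _ _
  have hvs : IsSolution A B E v := hf.linear_comb hg _ _
  have huv : u 1 * v 0 - u 0 * v 1 = 1 := by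
    rw [hu, hv]
    linear_combination (Real.cos t ^ 2 + Real.sin t ^ 2) * hfg + Real.cos_sq_add_sin_sq t
  set m := partialSum ((n : ℝ) + 1) fun k => u (k + 1) ^ 2 with hm
  set M := partialSum ((n : ℝ) + 1) fun k => v (k + 1) ^ 2 with hM
  have hm0 : 0 ≤ m := partialSum_nonneg _ fun k => sq_nonneg _
  have head : ∀ x : ℕ → ℝ, ∑ k ∈ range n, x (k + 1) ^ 2
      ≤ partialSum ((n : ℝ) + 1) fun k => x (k + 1) ^ 2 := fun x =>
    sum_range_le_partialSum (c := fun k => x (k + 1) ^ 2) (by linarith) fun k => sq_nonneg _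
  have tail : ∀ x : ℕ → ℝ, ∑ k ∈ range n, x (k + 2) ^ 2
      ≤ partialSum ((n : ℝ) + 1) fun k => x (k + 1) ^ 2 := fun x => by
    refine le_trans ?_ (partialSum_succ_le fun k => sq_nonneg _)
    rw [add_sub_cancel_right]
    exact sum_range_le_partialSum (c := fun k => x (k + 1 + 1) ^ 2) le_rfl fun k => sq_nonneg _
  have cs : ∀ x y : ℕ → ℝ, ∑ k ∈ range n, |x k * y k|
      ≤ √(∑ k ∈ range n, x k ^ 2) * √(∑ k ∈ range n, y k ^ 2) := fun x y => by
    have := Real.sum_mul_le_sqrt_mul_sqrt (range n) (fun k => |x k|) (fun k => |y k|)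
    simpa [abs_mul] using this
  calc ∑ k ∈ range n, |A (k + 1)|⁻¹
      ≤ ∑ k ∈ range n, (|u (k + 2) * v (k + 1)| + |u (k + 1) * v (k + 2)|) := by
        refine sum_le_sum fun k _ => ?_
        rw [abs_wronskian_inv hA hus hvs huv]
        exact abs_sub _ _
    _ ≤ √m * √M + √m * √M := by
        rw [sum_add_distrib]
        refine add_le_add ((cs (fun k => u (k + 2)) fun k => v (k + 1)).trans ?_)
          ((cs (fun k => u (k + 1)) fun k => v (k + 2)).trans ?_)
        · exact mul_le_mul (Real.sqrt_le_sqrt (tail u)) (Real.sqrt_le_sqrt (head v))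
            (Real.sqrt_nonneg _) (Real.sqrt_nonneg _)
        · exact mul_le_mul (Real.sqrt_le_sqrt (head u)) (Real.sqrt_le_sqrt (tail v))
            (Real.sqrt_nonneg _) (Real.sqrt_nonneg _)
    _ = 2 * √(gram f g (n + 1)) := by
        rw [← h2, Real.sqrt_mul hm0]; ring

theorem exists_lt_gram {A B f g : ℕ → ℝ} {E : ℝ} (hA : A 0 = 1) (hf : IsSolution A B E f)
    (hg : IsSolution A B E g) (hfg : f 1 * g 0 - f 0 * g 1 = 1)
    (hdiv : ¬ Summable fun n => |A (n + 1)|⁻¹) (K : ℝ) : ∃ s, 1 ≤ s ∧ K < gram f g s := by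
  by_contra! hcon
  refine hdiv (summable_of_sum_range_le (c := 2 * √K) (fun n => by positivity) fun n => ?_)
  refine (sum_abs_inv_le_gram hA hf hg hfg n).trans ?_
  gcongr
  exact hcon _ (by have : (0 : ℝ) ≤ n := Nat.cast_nonneg n
                   linarith)

theorem exists_gram_eq_of_le {f g : ℕ → ℝ} {s y : ℝ} (hy : 0 < y) (hs : y ≤ gram f g s) :
    ∃ t, 1 ≤ t ∧ t ≤ s ∧ gram f g t = y := by
  have h1 : 1 ≤ s := by
    by_contra! h
    rw [gram_eq_zero h.le] at hs
    linarith
  obtain ⟨t, ht, hty⟩ := intermediate_value_Icc h1 (continuous_gram f g).continuousOn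
    ⟨by rw [gram_eq_zero le_rfl]; exact hy.le, hs⟩
  exact ⟨t, ht.1, ht.2, hty⟩

/-! ### Truncated norms as interpolated partial sums -/

theorem sum_Icc_one_eq_sum_range (c : ℤ → ℝ) (m : ℕ) :
    ∑ n ∈ Icc (1 : ℤ) m, c n = ∑ k ∈ range m, c ((k + 1 : ℕ) : ℤ) := by
  symm
  refine sum_nbij (fun k : ℕ => ((k + 1 : ℕ) : ℤ)) ?_ ?_ ?_ fun _ _ => rfl
  · intro k hk
    simp only [mem_range, mem_Icc] at hk ⊢
    omega
  · intro k _ l _ h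
    simp only at h
    omega
  · intro n hn
    simp only [coe_Icc, Set.mem_Icc, Set.mem_image, coe_range, Set.mem_Iio] at hn ⊢
    exact ⟨(n - 1).toNat, by omega, by omega⟩

theorem sum_Icc_neg_eq_sum_range (c : ℤ → ℝ) (m : ℕ) :
    ∑ n ∈ Icc (-(m : ℤ)) (-1), c n = ∑ k ∈ range m, c (-((k + 1 : ℕ) : ℤ)) := by
  rw [← sum_Icc_one_eq_sum_range (fun n => c (-n))]
  refine sum_nbij (fun n => -n) ?_ ?_ ?_ fun n _ => by simp
  · intro k hk
    simp only [mem_Icc] at hk ⊢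
    omega
  · intro k _ l _ h
    simp only at h
    omega
  · intro n hn
    simp only [coe_Icc, Set.mem_Icc, Set.mem_image] at hn ⊢
    exact ⟨-n, by omega, by omega⟩

theorem sum_right_eq_partialSum (c : ℤ → ℝ) {L : ℝ} (hL : 0 ≤ L) :
    ∑ n ∈ Icc 1 ⌊L⌋, c n + (L - ⌊L⌋) * c (⌊L⌋ + 1)
      = partialSum L fun k => c ((k + 1 : ℕ) : ℤ) := by
  rw [partialSum_eq_floor hL, ← natCast_floor_eq_intCast_floor hL,
    ← Int.natCast_floor_eq_floor hL, sum_Icc_one_eq_sum_range]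
  push_cast
  rfl

theorem sum_left_eq_partialSum (c : ℤ → ℝ) {L : ℝ} (hL : 0 ≤ L) :
    ∑ n ∈ Icc (-⌊L⌋) (-1), c n + (L - ⌊L⌋) * c (-⌊L⌋ - 1)
      = partialSum L fun k => c (-((k + 1 : ℕ) : ℤ)) := by
  rw [partialSum_eq_floor hL, ← natCast_floor_eq_intCast_floor hL,
    ← Int.natCast_floor_eq_floor hL, sum_Icc_neg_eq_sum_range]
  push_cast
  ring_nf

/-- Site 0 belongs to the left half-line, so length L there corresponds to a partial sum of length L
+ 1. -/
theorem sum_left_zero_eq_partialSum (c : ℤ → ℝ) {L : ℝ} (hL : 0 ≤ L) :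
    ∑ n ∈ Icc (-⌊L⌋) 0, c n + (L - ⌊L⌋) * c (-⌊L⌋ - 1)
      = partialSum (L + 1) fun k => c (1 - ((k + 1 : ℕ) : ℤ)) := by
  have h0 : (0 : ℤ) ≤ ⌊L⌋ := Int.floor_nonneg.2 hL
  have h1 : Icc (-⌊L⌋) 0 = insert 0 (Icc (-⌊L⌋) (-1)) := by
    ext n; simp only [mem_Icc, mem_insert]; omega
  rw [h1, sum_insert (by simp), add_assoc, sum_left_eq_partialSum c hL,
    partialSum_eq_floor (by linarith : 0 ≤ L + 1), Nat.floor_add_one hL, sum_range_succ',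
    partialSum_eq_floor hL]
  push_cast
  have e : ∀ k : ℤ, 1 - (k + 1 + 1) = -(k + 1) := fun k => by ring
  simp only [e]
  ring_nf

theorem rightNormSq_eq_partialSum (φ : ℤ → ℝ) {L : ℝ} (hL : 0 ≤ L) :
    rightNormSq φ L = partialSum L fun k => φ ((k + 1 : ℕ) : ℤ) ^ 2 :=
  sum_right_eq_partialSum (fun n => φ n ^ 2) hL

theorem leftNormSq_eq_partialSum (φ : ℤ → ℝ) {L : ℝ} (hL : 0 ≤ L) :
    leftNormSq φ L = partialSum (L + 1) fun k => φ (1 - ((k + 1 : ℕ) : ℤ)) ^ 2 :=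
  sum_left_zero_eq_partialSum (fun n => φ n ^ 2) hL

theorem boxNormSq_eq_partialSum (φ : ℤ → ℂ) {L₁ L₂ : ℝ} (h₁ : 0 ≤ L₁) (h₂ : 0 ≤ L₂) :
    boxNormSq φ L₁ L₂ = partialSum (L₁ + 1) (fun k => ‖φ (1 - ((k + 1 : ℕ) : ℤ))‖ ^ 2)
      + partialSum L₂ fun k => ‖φ ((k + 1 : ℕ) : ℤ)‖ ^ 2 := by
  rw [← sum_left_zero_eq_partialSum (fun n => ‖φ n‖ ^ 2) h₁,
    ← sum_right_eq_partialSum (fun n => ‖φ n‖ ^ 2) h₂, boxNormSq]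
  have h0 : (0 : ℤ) ≤ ⌊L₁⌋ := Int.floor_nonneg.2 h₁
  have h0' : (0 : ℤ) ≤ ⌊L₂⌋ := Int.floor_nonneg.2 h₂
  have h1 : Icc (-⌊L₁⌋) ⌊L₂⌋ = Icc (-⌊L₁⌋) 0 ∪ Icc 1 ⌊L₂⌋ := by
    ext n; simp only [mem_Icc, mem_union]; omega
  have h2 : Disjoint (Icc (-⌊L₁⌋) 0) (Icc 1 ⌊L₂⌋) := by
    rw [disjoint_left]
    intro n hn hn'
    simp only [mem_Icc] at hn hn'
    omega
  rw [h1, sum_union h2]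
  ring

theorem rightTransferSq_eq_partialSum (a b : ℤ → ℝ) (E : ℝ) {L : ℝ} (hL : 1 ≤ L) :
    rightTransferSq a b E L
      = partialSum (L - 1) fun k => opNorm (transfer a b E ((k + 1 : ℕ) : ℤ)) ^ 2 := by
  have := sum_right_eq_partialSum (fun n => opNorm (transfer a b E n) ^ 2)
    (L := L - 1) (by linarith)
  rw [Int.floor_sub_one] at this
  rw [← this, rightTransferSq]
  push_cast
  ring_nf

theorem leftTransferSq_eq_partialSum (a b : ℤ → ℝ) (E : ℝ) {L : ℝ} (hL : 0 ≤ L) :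
    leftTransferSq a b E L
      = partialSum L fun k => opNorm (transfer a b E (-((k + 1 : ℕ) : ℤ))) ^ 2 :=
  sum_left_eq_partialSum (fun n => opNorm (transfer a b E n) ^ 2) hL

/-! ### The solutions on the two half-lines -/

theorem rightPair_eq (a b : ℤ → ℝ) (E θ : ℝ) (n : ℕ) :
    rightPair a b E θ n = Real.cos θ • rightPair a b E 0 n
      + Real.sin θ • rightPair a b E (Real.pi / 2) n := by
  induction n with
  | zero => simp [rightPair]
  | succ n ih =>
    simp only [rightPair, ih]
    ext
    · simp
    · simp; ring

theorem leftPair_eq (a b : ℤ → ℝ) (E θ : ℝ) (n : ℕ) :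
    leftPair a b E θ n = Real.cos θ • leftPair a b E 0 n
      + Real.sin θ • leftPair a b E (Real.pi / 2) n := by
  induction n with
  | zero => simp [leftPair]
  | succ n ih =>
    simp only [leftPair, ih]
    ext
    · simp; ring
    · simp

theorem sol_eq (a b : ℤ → ℝ) (E θ : ℝ) (n : ℤ) :
    sol a b E θ n = Real.cos θ * sol a b E 0 n + Real.sin θ * sol a b E (Real.pi / 2) n := by
  cases n with
  | ofNat n => simp only [sol, rightPair_eq a b E θ n]; simp
  | negSucc n => simp only [sol, leftPair_eq a b E θ (n + 1)]; simp

/-- `u_θ` on the sites `0, 1, 2, …`. -/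
def rightSol (a b : ℤ → ℝ) (E θ : ℝ) (n : ℕ) : ℝ := sol (normalized a) b E θ n

/-- `u_θ` on the sites `1, 0, -1, …`. -/
def leftSol (a b : ℤ → ℝ) (E θ : ℝ) (n : ℕ) : ℝ := sol (normalized a) b E θ (1 - n)

/-- The off-diagonal coefficients on the right half-line. -/
def rightCoeff (a : ℤ → ℝ) (n : ℕ) : ℝ := normalized a n

/-- The off-diagonal coefficients on the left half-line. -/
def leftCoeff (a : ℤ → ℝ) (n : ℕ) : ℝ := normalized a (-n)

theorem normalized_zero (a : ℤ → ℝ) : normalized a 0 = 1 := by simp [normalized]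

theorem normalized_of_ne (a : ℤ → ℝ) {n : ℤ} (hn : n ≠ 0) : normalized a n = a n := by
  simp [normalized, hn]

theorem normalized_ne_zero {a : ℤ → ℝ} (ha : ∀ n, a n ≠ 0) (n : ℤ) : normalized a n ≠ 0 := by
  by_cases h : n = 0
  · rw [h, normalized_zero]; exact one_ne_zero
  · rw [normalized_of_ne a h]; exact ha n

theorem rightCoeff_zero (a : ℤ → ℝ) : rightCoeff a 0 = 1 := by
  simp [rightCoeff, normalized_zero]

theorem leftCoeff_zero (a : ℤ → ℝ) : leftCoeff a 0 = 1 := by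
  simp [leftCoeff, normalized_zero]

theorem rightCoeff_succ (a : ℤ → ℝ) (n : ℕ) : rightCoeff a (n + 1) = a (n + 1) := by
  rw [rightCoeff, normalized_of_ne _ (by omega)]
  push_cast; rfl

theorem leftCoeff_succ (a : ℤ → ℝ) (n : ℕ) : leftCoeff a (n + 1) = a (-(n + 1)) := by
  rw [leftCoeff, normalized_of_ne _ (by omega)]
  push_cast; rfl

theorem isSolution_rightSol {a : ℤ → ℝ} (ha : ∀ n, a n ≠ 0) (b : ℤ → ℝ) (E θ : ℝ) :
    IsSolution (rightCoeff a) (fun n => b n) E (rightSol a b E θ) := fun n => by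
  have := sol_equation (normalized a) b (normalized_ne_zero ha) E θ (n + 1)
  simp only [rightCoeff, rightSol]
  push_cast
  rw [add_sub_cancel_right] at this
  rwa [show (n : ℤ) + 2 = n + 1 + 1 by ring]

theorem isSolution_leftSol {a : ℤ → ℝ} (ha : ∀ n, a n ≠ 0) (b : ℤ → ℝ) (E θ : ℝ) :
    IsSolution (leftCoeff a) (fun n => b (1 - n)) E (leftSol a b E θ) := fun n => by
  have := sol_equation (normalized a) b (normalized_ne_zero ha) E θ (-n)
  simp only [leftCoeff, leftSol]
  push_cast
  rw [show 1 - ((n : ℤ) + 2) = -n - 1 by ring, show 1 - ((n : ℤ) + 1) = -n by ring,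
    show -((n : ℤ) + 1) = -n - 1 by ring, show 1 - (n : ℤ) = -n + 1 by ring]
  linarith

theorem rightSol_initial (a b : ℤ → ℝ) (E : ℝ) :
    rightSol a b E 0 1 * rightSol a b E (Real.pi / 2) 0
      - rightSol a b E 0 0 * rightSol a b E (Real.pi / 2) 1 = 1 := by
  simp [rightSol, sol_zero, sol_one]

theorem leftSol_initial (a b : ℤ → ℝ) (E : ℝ) :
    leftSol a b E (Real.pi / 2) 1 * leftSol a b E 0 0
      - leftSol a b E (Real.pi / 2) 0 * leftSol a b E 0 1 = 1 := by
  simp [leftSol, sol_zero, sol_one]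

theorem not_summable_rightCoeff {a : ℤ → ℝ} (ha : IsJacobiData a) :
    ¬ Summable fun n => |rightCoeff a (n + 1)|⁻¹ := by
  simp only [rightCoeff_succ]
  exact ha.diverges_right

theorem not_summable_leftCoeff {a : ℤ → ℝ} (ha : IsJacobiData a) :
    ¬ Summable fun n => |leftCoeff a (n + 1)|⁻¹ := by
  simp only [leftCoeff_succ]
  exact ha.diverges_left

theorem gram_comm (f g : ℕ → ℝ) : gram f g = gram g f := by
  funext s
  simp only [gram, mul_comm]

/-- The Gram determinant on the right half-line. -/
def rightGram (a b : ℤ → ℝ) (E : ℝ) : ℝ → ℝ :=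
  gram (rightSol a b E 0) (rightSol a b E (Real.pi / 2))

/-- The Gram determinant on the left half-line. -/
def leftGram (a b : ℤ → ℝ) (E : ℝ) : ℝ → ℝ :=
  gram (leftSol a b E (Real.pi / 2)) (leftSol a b E 0)

/-- The set defining the scale is closed and, by the intermediate value theorem and divergence,
nonempty, so its infimum is attained. The offset d accounts for the extra site 0: d = 0 on the
right, d = 1 on the left. -/
theorem exists_gram_eq_of_sInf_le {A B f g : ℕ → ℝ} {E L d y : ℝ} (hA : A 0 = 1)
    (hf : IsSolution A B E f) (hg : IsSolution A B E g) (hfg : f 1 * g 0 - f 0 * g 1 = 1)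
    (hdiv : ¬ Summable fun n => |A (n + 1)|⁻¹) (hd : d ≤ 1) (hy : 0 < y) {S : Set ℝ}
    (hS : S = {L | 0 ≤ L ∧ gram f g (L + d) = y}) (hL : sInf S ≤ L) :
    ∃ s ≤ L + d, gram f g s = y := by
  have hcl : IsClosed S := by
    rw [hS]
    exact (isClosed_Ici (a := (0 : ℝ))).inter (isClosed_eq
      ((continuous_gram f g).comp (continuous_id.add continuous_const)) continuous_const)
  have hne : S.Nonempty := by
    obtain ⟨s, -, hs⟩ := exists_lt_gram hA hf hg hfg hdiv y
    obtain ⟨t, ht, -, hty⟩ := exists_gram_eq_of_le hy hs.le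
    refine ⟨t - d, ?_⟩
    rw [hS]
    exact ⟨by linarith, by rw [sub_add_cancel]; exact hty⟩
  have hbd : BddBelow S := ⟨0, fun x hx => by rw [hS] at hx; exact hx.1⟩
  have hmem := hcl.csInf_mem hne hbd
  have h2 : gram f g (sInf S + d) = y := by
    have : sInf S ∈ {L | 0 ≤ L ∧ gram f g (L + d) = y} := hS ▸ hmem
    exact this.2
  exact ⟨sInf S + d, by linarith, h2⟩

theorem sqrt_gram_eq_iff {f g : ℕ → ℝ} {s y : ℝ} (hy : 0 < y) :
    √(gram f g s) = y ↔ gram f g s = y ^ 2 := by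
  rw [Real.sqrt_eq_iff_eq_sq (gram_nonneg f g s) hy.le]

theorem rightNormSq_sol (a b : ℤ → ℝ) (E θ : ℝ) {L : ℝ} (hL : 0 ≤ L) :
    rightNormSq (sol (normalized a) b E θ) L = partialSum L fun k =>
      (Real.cos θ * rightSol a b E 0 (k + 1)
        + Real.sin θ * rightSol a b E (Real.pi / 2) (k + 1)) ^ 2 := by
  rw [rightNormSq_eq_partialSum _ hL]
  congr 1
  funext k
  rw [sol_eq (normalized a) b E θ]
  rfl

theorem leftNormSq_sol (a b : ℤ → ℝ) (E θ : ℝ) {L : ℝ} (hL : 0 ≤ L) :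
    leftNormSq (sol (normalized a) b E θ) L = partialSum (L + 1) fun k =>
      (Real.cos θ * leftSol a b E 0 (k + 1)
        + Real.sin θ * leftSol a b E (Real.pi / 2) (k + 1)) ^ 2 := by
  rw [leftNormSq_eq_partialSum _ hL]
  congr 1
  funext k
  rw [sol_eq (normalized a) b E θ]
  rfl

theorem exists_rightGram_eq {a : ℤ → ℝ} (ha : IsJacobiData a) (b : ℤ → ℝ) {E ε L : ℝ}
    (hε : 0 < ε) (h : scaleRight a b ε E ≤ L) : ∃ s ≤ L, rightGram a b E s = ε⁻¹ ^ 2 := by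
  have hε' : 0 < ε⁻¹ := by positivity
  have := exists_gram_eq_of_sInf_le (d := 0) (y := ε⁻¹ ^ 2) (rightCoeff_zero a)
    (isSolution_rightSol ha.ne_zero b E 0)
    (isSolution_rightSol ha.ne_zero b E (Real.pi / 2)) (rightSol_initial a b E)
    (not_summable_rightCoeff ha) zero_le_one (by positivity) ?_ h
  · simp only [add_zero] at this
    exact this
  · ext L
    refine and_congr_right fun hL => ?_
    simp only [rightNormSq_sol _ _ _ _ hL, add_zero]
    rw [← sqrt_gram_eq_iff hε', ← iSup_mul_iInf_sqrt]

theorem exists_leftGram_eq {a : ℤ → ℝ} (ha : IsJacobiData a) (b : ℤ → ℝ) {E ε L : ℝ}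
    (hε : 0 < ε) (h : scaleLeft a b ε E ≤ L) : ∃ s ≤ L + 1, leftGram a b E s = ε⁻¹ ^ 2 := by
  have hε' : 0 < ε⁻¹ := by positivity
  refine exists_gram_eq_of_sInf_le (d := 1) (y := ε⁻¹ ^ 2) (leftCoeff_zero a)
    (isSolution_leftSol ha.ne_zero b E (Real.pi / 2))
    (isSolution_leftSol ha.ne_zero b E 0) (leftSol_initial a b E)
    (not_summable_leftCoeff ha) le_rfl (by positivity) ?_ h
  ext L
  refine and_congr_right fun hL => ?_
  simp only [leftNormSq_sol _ _ _ _ hL]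
  rw [← sqrt_gram_eq_iff hε', gram_comm, ← iSup_mul_iInf_sqrt]

/-! ### Transfer matrix scales -/

theorem opNorm_nonneg (M : Matrix (Fin 2) (Fin 2) ℝ) : 0 ≤ opNorm M := norm_nonneg _

theorem opNorm_sq_ge (M : Matrix (Fin 2) (Fin 2) ℝ) (x y : ℝ) :
    (M 0 0 * x + M 0 1 * y) ^ 2 + (M 1 0 * x + M 1 1 * y) ^ 2
      ≤ opNorm M ^ 2 * (x ^ 2 + y ^ 2) := by
  have h := (Matrix.toEuclideanCLM (n := Fin 2) (𝕜 := ℝ) M).le_opNorm !₂[x, y]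
  have h2 := pow_le_pow_left₀ (norm_nonneg _) h 2
  rw [mul_pow, EuclideanSpace.real_norm_sq_eq, EuclideanSpace.real_norm_sq_eq] at h2
  simp only [Fin.sum_univ_two, Matrix.ofLp_toEuclideanCLM, Matrix.mulVec, dotProduct] at h2
  exact h2

theorem opNorm_sq_le (M : Matrix (Fin 2) (Fin 2) ℝ) :
    opNorm M ^ 2 ≤ M 0 0 ^ 2 + M 0 1 ^ 2 + M 1 0 ^ 2 + M 1 1 ^ 2 := by
  have hnn : 0 ≤ M 0 0 ^ 2 + M 0 1 ^ 2 + M 1 0 ^ 2 + M 1 1 ^ 2 := by positivity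
  rw [← Real.sq_sqrt hnn]
  refine pow_le_pow_left₀ (norm_nonneg _) ?_ 2
  refine ContinuousLinearMap.opNorm_le_bound _ (Real.sqrt_nonneg _) fun v => ?_
  refine le_of_sq_le_sq ?_ (by positivity)
  rw [mul_pow, Real.sq_sqrt hnn, EuclideanSpace.real_norm_sq_eq, EuclideanSpace.real_norm_sq_eq]
  simp only [Fin.sum_univ_two, Matrix.ofLp_toEuclideanCLM, Matrix.mulVec, dotProduct]
  nlinarith [sq_nonneg (M 0 0 * v 1 - M 0 1 * v 0), sq_nonneg (M 1 0 * v 1 - M 1 1 * v 0)]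

theorem sq_add_sq_le_opNorm_inv {M : Matrix (Fin 2) (Fin 2) ℝ} (hM : IsUnit M.det) (x y : ℝ) :
    x ^ 2 + y ^ 2 ≤ opNorm M⁻¹ ^ 2
      * ((M 0 0 * x + M 0 1 * y) ^ 2 + (M 1 0 * x + M 1 1 * y) ^ 2) := by
  refine le_trans (le_of_eq ?_) (opNorm_sq_ge M⁻¹ _ _)
  have h := Matrix.nonsing_inv_mul M hM
  have h00 := congrFun (congrFun h 0) 0
  have h01 := congrFun (congrFun h 0) 1
  have h10 := congrFun (congrFun h 1) 0
  have h11 := congrFun (congrFun h 1) 1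
  simp only [Matrix.mul_apply, Fin.sum_univ_two, Matrix.one_apply_eq] at h00 h11
  rw [Matrix.mul_apply, Fin.sum_univ_two, Matrix.one_apply_ne (by decide)] at h01 h10
  have e0 : M⁻¹ 0 0 * (M 0 0 * x + M 0 1 * y) + M⁻¹ 0 1 * (M 1 0 * x + M 1 1 * y) = x := by
    linear_combination x * h00 + y * h01
  have e1 : M⁻¹ 1 0 * (M 0 0 * x + M 0 1 * y) + M⁻¹ 1 1 * (M 1 0 * x + M 1 1 * y) = y := by
    linear_combination x * h10 + y * h11
  rw [e0, e1]

theorem opNorm_transfer_sq_le (a b : ℤ → ℝ) (E : ℝ) (n : ℤ) :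
    opNorm (transfer a b E n) ^ 2 ≤ sol a b E 0 (n + 1) ^ 2 + sol a b E (Real.pi / 2) (n + 1) ^ 2
      + sol a b E 0 n ^ 2 + sol a b E (Real.pi / 2) n ^ 2 := by
  simpa [transfer] using opNorm_sq_le (transfer a b E n)

theorem le_opNorm_transfer_sq (a b : ℤ → ℝ) (E : ℝ) (n : ℤ) :
    sol a b E 0 (n + 1) ^ 2 + sol a b E (Real.pi / 2) (n + 1) ^ 2
      + sol a b E 0 n ^ 2 + sol a b E (Real.pi / 2) n ^ 2 ≤ 2 * opNorm (transfer a b E n) ^ 2 := by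
  have h1 := opNorm_sq_ge (transfer a b E n) 1 0
  have h2 := opNorm_sq_ge (transfer a b E n) 0 1
  simp [transfer] at h1 h2
  simp only [transfer]
  linarith

/-- If the interpolated sum of squared transfer matrix norms is large, so is the Gram
determinant. -/
theorem gram_ge_of_transfer {f g P : ℕ → ℝ} {κ ε L s : ℝ}
    (hP : ∀ k, P (k + 1) ≤ f (k + 1) ^ 2 + f (k + 2) ^ 2 + g (k + 1) ^ 2 + g (k + 2) ^ 2)
    (hκ : ∀ x y : ℝ, x ^ 2 + y ^ 2
      ≤ κ ^ 2 * ((x * f 1 + y * g 1) ^ 2 + (x * f 2 + y * g 2) ^ 2))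
    (hLs : L ≤ s) (hs : 2 ≤ s)
    (hL : partialSum (L - 1) (fun k => P (k + 1)) = (2 * κ * ε⁻¹) ^ 2) :
    ε⁻¹ ^ 2 ≤ gram f g s := by
  obtain ⟨t, -, h2, h3, h4⟩ := exists_orthogonal_pair f g s
  set u : ℕ → ℝ := fun k => Real.cos t * f k + Real.sin t * g k with hu
  set m := partialSum s fun k => u (k + 1) ^ 2 with hm
  set M := partialSum s fun k => (-Real.sin t * f (k + 1) + Real.cos t * g (k + 1)) ^ 2
  set p := partialSum s fun k => f (k + 1) ^ 2
  set r := partialSum s fun k => g (k + 1) ^ 2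
  have h2m : u 1 ^ 2 + u 2 ^ 2 ≤ m := by
    have := sum_range_le_partialSum (s := s) (n := 2) (c := fun k => u (k + 1) ^ 2)
      (by exact_mod_cast hs) fun k => sq_nonneg _
    simpa [sum_range_succ] using this
  have h1m : 1 ≤ κ ^ 2 * m := by
    have := hκ (Real.cos t) (Real.sin t)
    rw [Real.cos_sq_add_sin_sq] at this
    exact this.trans (mul_le_mul_of_nonneg_left h2m (sq_nonneg κ))
  -- Consecutive transfer matrices share a site, so each site is counted at most twice.
  have hshift : ∀ x : ℕ → ℝ, partialSum (L - 1) (fun k => x (k + 1) ^ 2 + x (k + 2) ^ 2)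
      ≤ 2 * partialSum s fun k => x (k + 1) ^ 2 := fun x => by
    rw [partialSum_add]
    have e1 := partialSum_mono (show L - 1 ≤ s by linarith) (c := fun k => x (k + 1) ^ 2)
      fun k => sq_nonneg _
    have e2 := (partialSum_succ_le (s := L) (c := fun k => x (k + 1) ^ 2)
      fun k => sq_nonneg _).trans (partialSum_mono hLs fun k => sq_nonneg _)
    linarith
  have hup : (2 * κ * ε⁻¹) ^ 2 ≤ 2 * p + 2 * r := by
    rw [← hL]
    refine le_trans (partialSum_le_partialSum (d := fun k =>
      (f (k + 1) ^ 2 + f (k + 2) ^ 2) + (g (k + 1) ^ 2 + g (k + 2) ^ 2)) _ fun k _ => ?_) ?_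
    · have := hP k; linarith
    · rw [partialSum_add]
      exact add_le_add (hshift f) (hshift g)
  -- p + r = m + M ≤ 2M, which turns the bound 4κ²ε⁻² ≤ 2(p + r) into this one; the 2 in the
  -- definition of the scale is chosen for it.
  have hM : κ ^ 2 * ε⁻¹ ^ 2 ≤ M := by nlinarith
  rw [← h2]
  have hm0 : 0 ≤ m := partialSum_nonneg s fun k => sq_nonneg _
  calc ε⁻¹ ^ 2 ≤ (κ ^ 2 * m) * ε⁻¹ ^ 2 := by nlinarith [sq_nonneg ε⁻¹]
    _ = m * (κ ^ 2 * ε⁻¹ ^ 2) := by ring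
    _ ≤ m * M := by gcongr

/-- The infimum is attained as before, and `gram_ge_of_transfer` bounds the Gram determinant below
by ε⁻² at the end of the box; continuity gives an earlier point of equality. Here d = 1 on the
right, where L sites carry L - 1 transfer matrices, and d = 0 on the left, where site 0 is an
additional one. -/
theorem exists_gram_eq_of_transfer_sInf_le {A B f g P : ℕ → ℝ} {E κ ε L d : ℝ} (hA : A 0 = 1)
    (hf : IsSolution A B E f) (hg : IsSolution A B E g) (hfg : f 1 * g 0 - f 0 * g 1 = 1)
    (hdiv : ¬ Summable fun n => |A (n + 1)|⁻¹) (hε : 0 < ε)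
    (hP : ∀ k, P (k + 1) ≤ f (k + 1) ^ 2 + f (k + 2) ^ 2 + g (k + 1) ^ 2 + g (k + 2) ^ 2)
    (hP' : ∀ k, f (k + 1) ^ 2 + f (k + 2) ^ 2 + g (k + 1) ^ 2 + g (k + 2) ^ 2 ≤ 2 * P (k + 1))
    (hκ0 : 0 ≤ κ)
    (hκ : ∀ x y : ℝ, x ^ 2 + y ^ 2
      ≤ κ ^ 2 * ((x * f 1 + y * g 1) ^ 2 + (x * f 2 + y * g 2) ^ 2)) {S : Set ℝ}
    (hS : S = {L | d ≤ L ∧ √(partialSum (L - d) fun k => P (k + 1)) = 2 * κ * ε⁻¹})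
    (hd : d ≤ 1) (hL : sInf S ≤ L) (hL2 : 2 < L) :
    ∃ s ≤ L + (1 - d), gram f g s = ε⁻¹ ^ 2 := by
  have hP0 : ∀ k, 0 ≤ P (k + 1) := fun k => by
    have := hP' k
    have : 0 ≤ f (k + 1) ^ 2 + f (k + 2) ^ 2 + g (k + 1) ^ 2 + g (k + 2) ^ 2 := by positivity
    linarith
  have hcont : Continuous fun L => √(partialSum (L - d) fun k => P (k + 1)) :=
    ((continuous_partialSum _).comp (continuous_id.sub continuous_const)).sqrt
  have hκε : 0 ≤ 2 * κ * ε⁻¹ := by positivity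
  have hcl : IsClosed S := by
    rw [hS]
    exact (isClosed_Ici (a := d)).inter (isClosed_eq hcont continuous_const)
  -- The Wronskian identity gives |A(k+1)|⁻¹ ≤ P(k+1), so bounded sums of P would contradict
  -- divergence.
  have hunb : ∃ n : ℕ, (2 * κ * ε⁻¹) ^ 2 < ∑ k ∈ range n, P (k + 1) := by
    by_contra! hcon
    refine hdiv (summable_of_sum_range_le (c := (2 * κ * ε⁻¹) ^ 2) (fun n => by positivity)
      fun n => le_trans (sum_le_sum fun k _ => ?_) (hcon n))
    rw [abs_wronskian_inv hA hf hg hfg]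
    refine abs_le.2 ⟨?_, ?_⟩
    · nlinarith [hP' k, sq_nonneg (f (k + 2) + g (k + 1)), sq_nonneg (f (k + 1) - g (k + 2))]
    · nlinarith [hP' k, sq_nonneg (f (k + 2) - g (k + 1)), sq_nonneg (f (k + 1) + g (k + 2))]
  have hne : S.Nonempty := by
    obtain ⟨n, hn⟩ := hunb
    obtain ⟨t, ht, hty⟩ := intermediate_value_Icc
      (show d ≤ n + d by have : (0 : ℝ) ≤ n := Nat.cast_nonneg n
                         linarith) hcont.continuousOn
      (show 2 * κ * ε⁻¹ ∈ Set.Icc _ _ from ⟨by simpa [partialSum] using hκε, by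
        rw [add_sub_cancel_right]
        exact Real.le_sqrt_of_sq_le (hn.le.trans (sum_range_le_partialSum le_rfl hP0))⟩)
    exact ⟨t, by rw [hS]; exact ⟨ht.1, hty⟩⟩
  have hbd : BddBelow S := ⟨d, fun x hx => by rw [hS] at hx; exact hx.1⟩
  have hmem : sInf S ∈ {L | d ≤ L ∧ √(partialSum (L - d) fun k => P (k + 1)) = 2 * κ * ε⁻¹} :=
    hS ▸ hcl.csInf_mem hne hbd
  have h2 := hmem.2
  rw [Real.sqrt_eq_iff_eq_sq (partialSum_nonneg _ hP0) hκε] at h2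
  have h3 : ε⁻¹ ^ 2 ≤ gram f g (L + (1 - d)) :=
    gram_ge_of_transfer (L := sInf S + (1 - d)) hP hκ (by linarith) (by linarith)
      (by rw [← h2]; ring_nf)
  obtain ⟨s, -, hs, hsy⟩ := exists_gram_eq_of_le (by positivity) h3
  exact ⟨s, hs, hsy⟩

theorem isUnit_det_transfer {a : ℤ → ℝ} (ha : ∀ n, a n ≠ 0) (b : ℤ → ℝ) (E : ℝ) :
    IsUnit (transfer (normalized a) b E 1).det ∧ IsUnit (transfer (normalized a) b E (-1)).det := by
  constructor
  · have h := wronskian_eq_one (rightCoeff_zero a) (isSolution_rightSol ha b E 0)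
      (isSolution_rightSol ha b E (Real.pi / 2)) (rightSol_initial a b E) 1
    rw [isUnit_iff_ne_zero, Matrix.det_fin_two]
    intro h0
    simp only [transfer, Matrix.of_apply, Matrix.cons_val', Matrix.cons_val_zero,
      Matrix.cons_val_one, Matrix.cons_val_fin_one] at h0
    simp only [rightSol] at h
    push_cast at h
    norm_num at h h0
    have : (0 : ℝ) = 1 := by linear_combination h - rightCoeff a 1 * h0
    norm_num at this
  · have h := wronskian_eq_one (leftCoeff_zero a) (isSolution_leftSol ha b E (Real.pi / 2))
      (isSolution_leftSol ha b E 0) (leftSol_initial a b E) 1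
    rw [isUnit_iff_ne_zero, Matrix.det_fin_two]
    intro h0
    simp only [transfer, Matrix.of_apply, Matrix.cons_val', Matrix.cons_val_zero,
      Matrix.cons_val_one, Matrix.cons_val_fin_one] at h0
    simp only [leftSol] at h
    norm_num at h h0
    have : (0 : ℝ) = 1 := by linear_combination h - leftCoeff a 1 * h0
    norm_num at this

theorem exists_rightGram_eq_of_transfer {a : ℤ → ℝ} (ha : IsJacobiData a) (b : ℤ → ℝ)
    {E ε L : ℝ} (hε : 0 < ε) (h : transferScaleRight a b ε E ≤ L) (hL : 2 < L) :
    ∃ s ≤ L, rightGram a b E s = ε⁻¹ ^ 2 := by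
  have := exists_gram_eq_of_transfer_sInf_le (d := 1)
    (P := fun k => opNorm (transfer (normalized a) b E k) ^ 2)
    (κ := opNorm (transfer (normalized a) b E 1)⁻¹) (rightCoeff_zero a)
    (isSolution_rightSol ha.ne_zero b E 0)
    (isSolution_rightSol ha.ne_zero b E (Real.pi / 2)) (rightSol_initial a b E)
    (not_summable_rightCoeff ha) hε ?_ ?_ (opNorm_nonneg _) ?_ ?_ le_rfl h hL
  · simp only [sub_self, add_zero] at this
    exact this
  · intro k
    have := opNorm_transfer_sq_le (normalized a) b E ((k + 1 : ℕ) : ℤ)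
    simp only [rightSol]
    push_cast at this ⊢
    rw [show (k : ℤ) + 2 = k + 1 + 1 by ring]
    linarith
  · intro k
    have := le_opNorm_transfer_sq (normalized a) b E ((k + 1 : ℕ) : ℤ)
    simp only [rightSol]
    push_cast at this ⊢
    rw [show (k : ℤ) + 2 = k + 1 + 1 by ring]
    linarith
  · intro x y
    have := sq_add_sq_le_opNorm_inv (isUnit_det_transfer ha.ne_zero b E).1 x y
    refine this.trans (le_of_eq ?_)
    simp [transfer, rightSol]
    ring_nf
    simp
  · ext L
    refine and_congr_right fun hL => ?_
    rw [rightTransferSq_eq_partialSum _ _ _ hL]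

theorem exists_leftGram_eq_of_transfer {a : ℤ → ℝ} (ha : IsJacobiData a) (b : ℤ → ℝ)
    {E ε L : ℝ} (hε : 0 < ε) (h : transferScaleLeft a b ε E ≤ L) (hL : 2 < L) :
    ∃ s ≤ L + 1, leftGram a b E s = ε⁻¹ ^ 2 := by
  have := exists_gram_eq_of_transfer_sInf_le (d := 0)
    (P := fun k => opNorm (transfer (normalized a) b E (-k)) ^ 2)
    (κ := opNorm (transfer (normalized a) b E (-1))⁻¹) (leftCoeff_zero a)
    (isSolution_leftSol ha.ne_zero b E (Real.pi / 2))
    (isSolution_leftSol ha.ne_zero b E 0) (leftSol_initial a b E)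
    (not_summable_leftCoeff ha) hε ?_ ?_ (opNorm_nonneg _) ?_ ?_ zero_le_one h hL
  · simp only [sub_zero] at this
    exact this
  · intro k
    have := opNorm_transfer_sq_le (normalized a) b E (-((k + 1 : ℕ) : ℤ))
    simp only [leftSol]
    push_cast at this ⊢
    rw [show 1 - ((k : ℤ) + 2) = -(k + 1) by ring, show 1 - ((k : ℤ) + 1) = -(k + 1) + 1 by ring]
    linarith
  · intro k
    have := le_opNorm_transfer_sq (normalized a) b E (-((k + 1 : ℕ) : ℤ))
    simp only [leftSol]
    push_cast at this ⊢
    rw [show 1 - ((k : ℤ) + 2) = -(k + 1) by ring, show 1 - ((k : ℤ) + 1) = -(k + 1) + 1 by ring]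
    linarith
  · intro x y
    -- The left pair is ordered π/2, 0 so that its Wronskian is +1, hence x and y are exchanged.
    have := sq_add_sq_le_opNorm_inv (isUnit_det_transfer ha.ne_zero b E).2 y x
    rw [add_comm]
    refine this.trans (le_of_eq ?_)
    simp [transfer, leftSol]
    ring_nf
    simp
  · ext L
    refine and_congr_right fun hL => ?_
    rw [leftTransferSq_eq_partialSum _ _ _ hL, sub_zero]

end JacobiDyn

end

/-! ### Plancherel for the half-line Laplace transform -/

noncomputable section

namespace JacobiDyn

open MeasureTheory FourierTransform SchwartzMap

/-- The `L²` Fourier transform of an integrable square-integrable function is given by the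
Fourier integral. -/
theorem coeFn_fourier_toLp_ae_eq {f : ℝ → ℂ} (hf : Integrable f) (hf2 : MemLp f 2) :
    ((𝓕 (hf2.toLp f) : Lp (α := ℝ) ℂ 2 volume) : ℝ → ℂ) =ᵐ[volume] 𝓕 f := by
  have hcont : Continuous (𝓕 f) :=
    VectorFourier.fourierIntegral_continuous Real.continuous_fourierChar
      (by exact continuous_inner) hf
  refine ae_eq_of_integral_contDiff_smul_eq
    ((Lp.memLp _).locallyIntegrable (by norm_num)) hcont.locallyIntegrable fun g hg hgs => ?_
  have hgc : HasCompactSupport fun x => (g x : ℂ) := hgs.comp_left (g := Complex.ofReal) rfl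
  have hgd : ContDiff ℝ (⊤ : ℕ∞) fun x => (g x : ℂ) := Complex.ofRealCLM.contDiff.comp hg
  set G : 𝓢(ℝ, ℂ) := hgc.toSchwartzMap hgd with hG
  have hGg : ∀ x, G x = (g x : ℂ) := fun x => rfl
  have h1 := Lp.fourier_toTemperedDistribution_eq (hf2.toLp f)
  have h2 := DFunLike.congr_fun h1 G
  rw [TemperedDistribution.fourier_apply, Lp.toTemperedDistribution_apply,
    Lp.toTemperedDistribution_apply] at h2
  -- The multiplication formula for the Fourier integral; the distributional definition gives the
  -- same pairing for the L² transform, so both agree against all test functions.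
  have h3 : ∫ x, 𝓕 f x • G x = ∫ x, f x • 𝓕 (G : ℝ → ℂ) x := by
    have := VectorFourier.integral_fourierIntegral_smul_eq_flip (μ := volume) (ν := volume)
      (L := innerₗ ℝ) Real.continuous_fourierChar (by exact continuous_inner) hf G.integrable
    rw [flip_innerₗ] at this
    exact this
  have e1 : ∀ x, g x • ((𝓕 (hf2.toLp f) : Lp (α := ℝ) ℂ 2 volume) : ℝ → ℂ) x
      = G x • ((𝓕 (hf2.toLp f) : Lp (α := ℝ) ℂ 2 volume) : ℝ → ℂ) x := fun x => by
    rw [hGg]; simp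
  have e2 : ∀ x, g x • 𝓕 f x = 𝓕 f x • G x := fun x => by
    rw [hGg]; simp [mul_comm]
  simp only [e1, e2]
  rw [← h2, h3]
  refine integral_congr_ae ?_
  filter_upwards [hf2.coeFn_toLp] with x hx
  rw [hx, SchwartzMap.fourier_coe]
  simp [mul_comm]

theorem memLp_fourier {f : ℝ → ℂ} (hf : Integrable f) (hf2 : MemLp f 2) : MemLp (𝓕 f) 2 :=
  (memLp_congr_ae (coeFn_fourier_toLp_ae_eq hf hf2)).1 (Lp.memLp _)

/-- Plancherel's theorem for functions in `L¹ ∩ L²`. -/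
theorem integral_norm_fourier_sq {f : ℝ → ℂ} (hf : Integrable f) (hf2 : MemLp f 2) :
    ∫ x, ‖𝓕 f x‖ ^ 2 = ∫ x, ‖f x‖ ^ 2 := by
  have h := Lp.inner_fourier_eq (hf2.toLp f) (hf2.toLp f)
  have key : ∀ (F : Lp (α := ℝ) ℂ 2 volume), inner ℂ F F = ((∫ x, ‖F x‖ ^ 2 : ℝ) : ℂ) := fun F => by
    rw [L2.inner_def, ← integral_complex_ofReal]
    refine integral_congr_ae (Filter.Eventually.of_forall fun x => ?_)
    simp only [inner_self_eq_norm_sq_to_K]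
    simp
  rw [key, key] at h
  have h' : (∫ x, ‖((𝓕 (hf2.toLp f) : Lp (α := ℝ) ℂ 2 volume) : ℝ → ℂ) x‖ ^ 2)
      = ∫ x, ‖(hf2.toLp f) x‖ ^ 2 := by exact_mod_cast h
  rw [integral_congr_ae (g := fun x => ‖((𝓕 (hf2.toLp f) : Lp (α := ℝ) ℂ 2 volume) : ℝ → ℂ) x‖ ^ 2), h']
  · refine integral_congr_ae ?_
    filter_upwards [hf2.coeFn_toLp] with x hx
    rw [hx]
  · filter_upwards [coeFn_fourier_toLp_ae_eq hf hf2] with x hx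
    rw [hx]

/-- Plancherel's theorem for a half-line Fourier–Laplace transform. -/
theorem integral_norm_laplace_sq {φ : ℝ → ℂ} {ε : ℝ} (hε : 0 < ε) (hφ : Continuous φ)
    (hb : ∀ t, ‖φ t‖ ≤ 1) :
    Integrable (fun E : ℝ =>
      ‖∫ t in Set.Ioi (0 : ℝ), Complex.exp (Complex.I * (E + ε * Complex.I) * t) * φ t‖ ^ 2) ∧
    ∫ E : ℝ, ‖∫ t in Set.Ioi (0 : ℝ), Complex.exp (Complex.I * (E + ε * Complex.I) * t) * φ t‖ ^ 2
      = 2 * Real.pi * ∫ t in Set.Ioi (0 : ℝ), Real.exp (-2 * ε * t) * ‖φ t‖ ^ 2 := by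
  set f : ℝ → ℂ := (Set.Ioi (0 : ℝ)).indicator fun t => (Real.exp (-ε * t) : ℂ) * φ t with hf
  have hcont : Continuous fun t : ℝ => (Real.exp (-ε * t) : ℂ) * φ t := by fun_prop
  have hfi : Integrable f := by
    rw [hf, integrable_indicator_iff measurableSet_Ioi]
    refine Integrable.mono' (exp_neg_integrableOn_Ioi 0 hε) hcont.aestronglyMeasurable ?_
    refine Filter.Eventually.of_forall fun t => ?_
    rw [norm_mul, Complex.norm_real, Real.norm_eq_abs, Real.abs_exp]
    exact mul_le_of_le_one_right (Real.exp_pos _).le (hb t)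
  have hfsq : ∀ t, ‖f t‖ ^ 2
      = (Set.Ioi (0 : ℝ)).indicator (fun t => Real.exp (-2 * ε * t) * ‖φ t‖ ^ 2) t := fun t => by
    by_cases ht : t ∈ Set.Ioi (0 : ℝ)
    · rw [hf, Set.indicator_of_mem ht, Set.indicator_of_mem ht, norm_mul, mul_pow,
        Complex.norm_real, Real.norm_eq_abs, Real.abs_exp, ← Real.exp_nat_mul]
      congr 2
      push_cast; ring
    · rw [hf, Set.indicator_of_notMem ht, Set.indicator_of_notMem ht]; simp
  have hcont2 : Continuous fun t : ℝ => Real.exp (-2 * ε * t) * ‖φ t‖ ^ 2 := by fun_prop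
  have hf2 : MemLp f 2 := by
    rw [memLp_two_iff_integrable_sq_norm hfi.1]
    simp only [hfsq]
    refine (integrable_indicator_iff measurableSet_Ioi).2 ?_
    refine Integrable.mono' (exp_neg_integrableOn_Ioi 0 (show 0 < 2 * ε by positivity))
      hcont2.aestronglyMeasurable ?_
    refine Filter.Eventually.of_forall fun t => ?_
    rw [Real.norm_of_nonneg (by positivity), neg_mul]
    exact mul_le_of_le_one_right (Real.exp_pos _).le (pow_le_one₀ (norm_nonneg _) (hb t))
  -- The Laplace integral is the Fourier transform of f at frequency -E/(2π); this rescaling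
  -- produces the factor 2π.
  have hlap : ∀ E : ℝ, (∫ t in Set.Ioi (0 : ℝ),
      Complex.exp (Complex.I * (E + ε * Complex.I) * t) * φ t)
        = 𝓕 f (E * (-(2 * Real.pi)⁻¹)) := fun E => by
    rw [Real.fourier_eq', ← integral_indicator measurableSet_Ioi]
    refine integral_congr_ae (Filter.Eventually.of_forall fun t => ?_)
    by_cases ht : t ∈ Set.Ioi (0 : ℝ)
    · simp only [hf, Set.indicator_of_mem ht, smul_eq_mul]
      rw [← mul_assoc, Complex.ofReal_exp, ← Complex.exp_add]
      congr 2
      have hpi : (Real.pi : ℂ) ≠ 0 := by exact_mod_cast Real.pi_ne_zero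
      simp only [RCLike.inner_apply, conj_trivial]
      push_cast
      field_simp
      linear_combination (t * ε : ℂ) * Complex.I_sq
    · simp only [hf, Set.indicator_of_notMem ht, smul_zero]
  simp only [hlap]
  have hint : Integrable fun x => ‖𝓕 f x‖ ^ 2 :=
    (memLp_fourier hfi hf2).integrable_norm_pow (by norm_num)
  have hne : (-(2 * Real.pi)⁻¹) ≠ 0 := by
    have := Real.pi_pos
    exact neg_ne_zero.2 (by positivity)
  refine ⟨hint.comp_mul_right' hne, ?_⟩
  rw [Measure.integral_comp_mul_right (fun x => ‖𝓕 f x‖ ^ 2), integral_norm_fourier_sq hfi hf2]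
  simp only [hfsq]
  rw [integral_indicator measurableSet_Ioi, inv_neg, inv_inv, abs_neg,
    abs_of_pos (by have := Real.pi_pos
                   positivity), smul_eq_mul]

end JacobiDyn

end

noncomputable section

namespace JacobiDyn

open MeasureTheory Filter Topology

/-! ### Symmetry of the maximal operator -/

/-- A nonzero limit would make |A n|⁻¹ eventually at most a constant times the summable p n. -/
theorem eq_zero_of_tendsto_of_not_summable {A J p : ℕ → ℝ} {l : ℝ} (hA : ∀ n, A n ≠ 0)
    (hJ : ∀ n, |J n| ≤ |A n| * p n) (hp : Summable p) (hdiv : ¬ Summable fun n => |A n|⁻¹)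
    (hl : Tendsto J atTop (𝓝 l)) : l = 0 := by
  by_contra hne
  have hl0 : 0 < |l| := abs_pos.2 hne
  have hev : ∀ᶠ n in atTop, |l| / 2 < |J n| := hl.abs.eventually_const_lt (by linarith)
  refine hdiv (Summable.of_norm_bounded_eventually_nat (hp.mul_left (2 / |l|)) ?_)
  filter_upwards [hev] with n hn
  have hAn : 0 < |A n| := abs_pos.2 (hA n)
  rw [norm_inv, Real.norm_eq_abs, abs_abs, inv_le_iff_one_le_mul₀ hAn]
  have h := hn.le.trans (hJ n)
  calc (1 : ℝ) = 2 / |l| * (|l| / 2) := by field_simp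
    _ ≤ 2 / |l| * (|A n| * p n) := by gcongr
    _ = _ := by ring

theorem summable_norm_mul_norm_succ (u : ℓ²(ℤ, ℂ)) : Summable fun n : ℤ => ‖u n‖ * ‖u (n + 1)‖ := by
  have h : Summable fun n : ℤ => ‖u n‖ ^ 2 := by
    have := (lp.memℓp u).summable (by norm_num)
    simpa using this
  have h' : Summable fun n : ℤ => ‖u (n + 1)‖ ^ 2 :=
    h.comp_injective (add_left_injective (1 : ℤ))
  refine Summable.of_nonneg_of_le (fun n => by positivity) (fun n => ?_) (h.add h')
  nlinarith [sq_nonneg (‖u n‖ - ‖u (n + 1)‖), sq_nonneg (‖u n‖), sq_nonneg (‖u (n + 1)‖)]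

/-- The imaginary part of the inner product is a telescoping sum of currents J. The currents
converge at both ends, and divergence of Σ 1/|a| forces both limits to vanish. -/
theorem inner_jacobiOperator_im {a : ℤ → ℝ} (ha : IsJacobiData a) (b : ℤ → ℝ)
    (u : (jacobiOperator a b).domain) :
    (inner ℂ (u : ℓ²(ℤ, ℂ)) (jacobiOperator a b u)).im = 0 := by
  set v : ℓ²(ℤ, ℂ) := u.1
  set J : ℤ → ℝ := fun n => a n * ((starRingEnd ℂ) (v n) * v (n + 1)).im with hJ
  set G : ℤ → ℝ := fun n => (inner ℂ (v n) (jacobiOperator a b u n)).im with hG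
  have hGJ : ∀ n, G n = J n - J (n - 1) := fun n => by
    have e : jacobiOperator a b u n = jacobiExpr a b v n := rfl
    simp only [hG, hJ, e, jacobiExpr, RCLike.inner_apply]
    simp
    ring
  have hsum : HasSum G (inner ℂ v (jacobiOperator a b u)).im :=
    Complex.hasSum_im (lp.hasSum_inner v (jacobiOperator a b u))
  have hJle : ∀ n, |J n| ≤ |a n| * (‖v n‖ * ‖v (n + 1)‖) := fun n => by
    rw [hJ, abs_mul]
    gcongr
    refine (Complex.abs_im_le_norm _).trans (le_of_eq ?_)
    rw [norm_mul, RCLike.norm_conj]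
  have hsr : Summable fun n : ℕ => G n := hsum.summable.comp_injective Nat.cast_injective
  have hsl : Summable fun n : ℕ => G (-(n + 1 : ℤ)) :=
    hsum.summable.comp_injective fun m n h => by simpa using h
  have hr : ∀ N : ℕ, ∑ n ∈ Finset.range N, G n = J (N - 1) - J (-1) := fun N => by
    induction N with
    | zero => simp
    | succ N ih =>
      rw [Finset.sum_range_succ, ih, hGJ]; push_cast; rw [add_sub_cancel_right]; ring
  have hl : ∀ N : ℕ, ∑ n ∈ Finset.range N, G (-(n + 1 : ℤ)) = J (-1) - J (-(N + 1)) := fun N => by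
    induction N with
    | zero => simp
    | succ N ih =>
      rw [Finset.sum_range_succ, ih, hGJ]; push_cast
      rw [show -((N : ℤ) + 1) - 1 = -(N + 1 + 1) by ring]; ring
  have hinj : Function.Injective fun n : ℕ => ((n : ℤ) + 1) := fun m n h => by simpa using h
  have hinj' : Function.Injective fun n : ℕ => (-((n : ℤ) + 1)) := fun m n h => by simpa using h
  have hR : ∑' n : ℕ, G n = - J (-1) := by
    have ht := hsr.hasSum.tendsto_sum_nat
    simp only [hr] at ht
    have ht2 := (tendsto_add_atTop_iff_nat 2).2 (ht.add_const (J (-1)))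
    have := eq_zero_of_tendsto_of_not_summable (A := fun n : ℕ => a (n + 1))
      (J := fun n : ℕ => J (n + 1)) (p := fun n : ℕ => ‖v (n + 1)‖ * ‖v (n + 1 + 1)‖)
      (fun n => ha.ne_zero _) (fun n => hJle _)
      ((summable_norm_mul_norm_succ v).comp_injective hinj) ha.diverges_right
      (ht2.congr fun n => by
        push_cast; rw [sub_add_cancel]; congr 1; ring)
    linarith
  have hL : ∑' n : ℕ, G (-(n + 1 : ℤ)) = J (-1) := by
    have ht := hsl.hasSum.tendsto_sum_nat
    simp only [hl] at ht
    have ht2 := ht.sub_const (J (-1))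
    have ht3 := ht2.neg
    have := eq_zero_of_tendsto_of_not_summable (A := fun n : ℕ => a (-((n : ℤ) + 1)))
      (J := fun n : ℕ => J (-((n : ℤ) + 1)))
      (p := fun n : ℕ => ‖v (-((n : ℤ) + 1))‖ * ‖v (-((n : ℤ) + 1) + 1)‖)
      (fun n => ha.ne_zero _) (fun n => hJle _)
      ((summable_norm_mul_norm_succ v).comp_injective hinj') ha.diverges_left
      (ht3.congr fun n => by ring)
    linarith
  have := HasSum.of_nat_of_neg_add_one hsr.hasSum hsl.hasSum
  rw [hR, hL, neg_add_cancel] at this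
  exact hsum.unique this

theorem eq_zero_of_jacobiOperator_eq_smul {a : ℤ → ℝ} (ha : IsJacobiData a) (b : ℤ → ℝ)
    {z : ℂ} (hz : z.im ≠ 0) (u : (jacobiOperator a b).domain)
    (hu : jacobiOperator a b u = z • (u : ℓ²(ℤ, ℂ))) : (u : ℓ²(ℤ, ℂ)) = 0 := by
  have h := inner_jacobiOperator_im ha b u
  rw [hu, inner_smul_right, inner_self_eq_norm_sq_to_K, Complex.mul_im] at h
  have e : (((‖(u : ℓ²(ℤ, ℂ))‖ : ℂ)) ^ 2) = ((‖(u : ℓ²(ℤ, ℂ))‖ ^ 2 : ℝ) : ℂ) := by push_cast; rfl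
  simp only [Complex.coe_algebraMap, e, Complex.ofReal_im, Complex.ofReal_re, mul_zero,
    zero_add] at h
  simpa [hz] using h

/-! ### The evolution and its Laplace transform -/

/-- The derivative of ⟨ψ, ψ⟩ is zero because ⟨v, Hv⟩ is real on the domain. -/
theorem IsEvolution.norm_eq {a b : ℤ → ℝ} (ha : IsJacobiData a) {ψ₀ : ℓ²(ℤ, ℂ)}
    {ψ : ℝ → ℓ²(ℤ, ℂ)} (hψ : IsEvolution (jacobiOperator a b) ψ₀ ψ) (t : ℝ) :
    ‖ψ t‖ = ‖ψ₀‖ := by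
  have hd : ∀ t, HasDerivAt (fun s => inner ℂ (ψ s) (ψ s)) 0 t := fun t => by
    obtain ⟨v, hv, hder⟩ := hψ.2 t
    refine (hder.inner ℂ hder).congr_deriv ?_
    have h := inner_jacobiOperator_im ha b v
    rw [← hv, inner_smul_right, inner_smul_left, ← inner_conj_symm (jacobiOperator a b v)]
    set x := inner ℂ (v : ℓ²(ℤ, ℂ)) (jacobiOperator a b v)
    rw [Complex.conj_eq_iff_im.2 h]
    simp
  have hc := is_const_of_deriv_eq_zero (fun t => (hd t).differentiableAt) (fun t => (hd t).deriv)
    t 0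
  simp only [hψ.1, inner_self_eq_norm_sq_to_K] at hc
  have : ‖ψ t‖ ^ 2 = ‖ψ₀‖ ^ 2 := by exact_mod_cast hc
  exact (pow_left_inj₀ (norm_nonneg _) (norm_nonneg _) two_ne_zero).1 this

theorem norm_delta1 : ‖delta1‖ = 1 := by
  rw [delta1, lp.norm_single (by norm_num)]; simp

theorem delta1_apply (n : ℤ) : delta1 n = if n = 1 then 1 else 0 := by
  simp [delta1, Pi.single_apply]

section Evolution

variable {a b : ℤ → ℝ} {ψ : ℝ → ℓ²(ℤ, ℂ)}

theorem IsEvolution.continuous {ψ₀ : ℓ²(ℤ, ℂ)} (hψ : IsEvolution (jacobiOperator a b) ψ₀ ψ) :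
    Continuous ψ :=
  continuous_iff_continuousAt.2 fun t => by
    obtain ⟨v, -, hd⟩ := hψ.2 t
    exact hd.continuousAt

theorem IsEvolution.continuous_apply {ψ₀ : ℓ²(ℤ, ℂ)}
    (hψ : IsEvolution (jacobiOperator a b) ψ₀ ψ) (n : ℤ) : Continuous fun t => ψ t n :=
  (lp.evalCLM ℂ (fun _ : ℤ => ℂ) 2 n).continuous.comp hψ.continuous

theorem IsEvolution.hasDerivAt_apply {ψ₀ : ℓ²(ℤ, ℂ)}
    (hψ : IsEvolution (jacobiOperator a b) ψ₀ ψ) (n : ℤ) (t : ℝ) :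
    HasDerivAt (fun t => ψ t n) (-Complex.I * jacobiExpr a b (ψ t) n) t := by
  obtain ⟨v, hv, hd⟩ := hψ.2 t
  have h := ((lp.evalCLM ℂ (fun _ : ℤ => ℂ) 2 n).restrictScalars ℝ).hasFDerivAt.comp_hasDerivAt t hd
  refine h.congr_deriv ?_
  rw [← hv]
  rfl

theorem IsEvolution.norm_apply_le (ha : IsJacobiData a)
    (hψ : IsEvolution (jacobiOperator a b) delta1 ψ) (n : ℤ) (t : ℝ) : ‖ψ t n‖ ≤ 1 := by
  refine (lp.norm_apply_le_norm (by norm_num) (ψ t) n).trans (le_of_eq ?_)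
  rw [hψ.norm_eq ha, norm_delta1]

theorem norm_exp_I_mul (z : ℂ) (t : ℝ) :
    ‖Complex.exp (Complex.I * z * t)‖ = Real.exp (-z.im * t) := by
  rw [Complex.norm_exp]
  congr 1
  simp

/-- The Laplace transform `i ∫₀^∞ e^{izt} ψ(t) dt`. -/
def laplace (ψ : ℝ → ℓ²(ℤ, ℂ)) (z : ℂ) : ℓ²(ℤ, ℂ) :=
  Complex.I • ∫ t in Set.Ioi (0 : ℝ), Complex.exp (Complex.I * z * t) • ψ t

theorem integrableOn_exp_smul {X : Type*} [NormedAddCommGroup X] [NormedSpace ℂ X]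
    [SecondCountableTopologyEither ℝ X] {φ : ℝ → X}
    (hφ : Continuous φ) {K : ℝ} (hK : ∀ t, ‖φ t‖ ≤ K) {z : ℂ} (hz : 0 < z.im) :
    IntegrableOn (fun t : ℝ => Complex.exp (Complex.I * z * t) • φ t) (Set.Ioi 0) := by
  refine Integrable.mono' ((exp_neg_integrableOn_Ioi 0 hz).mul_const K)
    (Continuous.aestronglyMeasurable (by fun_prop)) (Eventually.of_forall fun t => ?_)
  rw [norm_smul, norm_exp_I_mul]
  exact mul_le_mul_of_nonneg_left (hK t) (Real.exp_pos _).le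

theorem IsEvolution.laplace_apply (ha : IsJacobiData a)
    (hψ : IsEvolution (jacobiOperator a b) delta1 ψ) {z : ℂ} (hz : 0 < z.im) (n : ℤ) :
    laplace ψ z n
      = Complex.I * ∫ t in Set.Ioi (0 : ℝ), Complex.exp (Complex.I * z * t) * ψ t n := by
  have h := (lp.evalCLM ℂ (fun _ : ℤ => ℂ) 2 n).integral_comp_comm
    (integrableOn_exp_smul hψ.continuous (fun t => (hψ.norm_eq ha t).le) hz)
  change Complex.I * (lp.evalCLM ℂ (fun _ : ℤ => ℂ) 2 n) _ = _
  rw [← h]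
  rfl

/-- Integrate the derivative of e^{izt} ψ(t)(n) over (0, ∞): the boundary term at 0 is δ₁(n), and
the one at infinity vanishes. Working at one site keeps H a finite combination of coordinates, which
passes through the integral. -/
theorem IsEvolution.jacobiExpr_laplace (ha : IsJacobiData a)
    (hψ : IsEvolution (jacobiOperator a b) delta1 ψ) {z : ℂ} (hz : 0 < z.im) (n : ℤ) :
    jacobiExpr a b (laplace ψ z) n = delta1 n + z * laplace ψ z n := by
  set e : ℝ → ℂ := fun t => Complex.exp (Complex.I * z * t) with he
  have hint : ∀ n, IntegrableOn (fun t => e t * ψ t n) (Set.Ioi 0) := fun n =>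
    integrableOn_exp_smul (hψ.continuous_apply n) (hψ.norm_apply_le ha n) hz
  have hde : ∀ t : ℝ, HasDerivAt e (Complex.I * z * e t) t := fun t => by
    have h1 : HasDerivAt (fun t : ℝ => Complex.I * z * (t : ℂ)) (Complex.I * z) t := by
      simpa using (Complex.ofRealCLM.hasDerivAt (x := t)).const_mul (Complex.I * z)
    simpa [he, mul_comm] using h1.cexp
  have hexpand : ∀ t, e t * jacobiExpr a b (ψ t) n
      = (a n : ℂ) * (e t * ψ t (n + 1)) + (a (n - 1) : ℂ) * (e t * ψ t (n - 1))
        + (b n : ℂ) * (e t * ψ t n) := fun t => by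
    simp only [jacobiExpr]; ring
  have i₁ : IntegrableOn (fun t => (a n : ℂ) * (e t * ψ t (n + 1))) (Set.Ioi 0) :=
    (hint _).const_mul _
  have i₂ : IntegrableOn (fun t => (a (n - 1) : ℂ) * (e t * ψ t (n - 1))) (Set.Ioi 0) :=
    (hint _).const_mul _
  have i₃ : IntegrableOn (fun t => (b n : ℂ) * (e t * ψ t n)) (Set.Ioi 0) := (hint _).const_mul _
  have i₁₂ : IntegrableOn (fun t => (a n : ℂ) * (e t * ψ t (n + 1))
      + (a (n - 1) : ℂ) * (e t * ψ t (n - 1))) (Set.Ioi 0) := i₁.add i₂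
  have hHint : IntegrableOn (fun t => e t * jacobiExpr a b (ψ t) n) (Set.Ioi 0) := by
    simp only [hexpand]
    exact i₁₂.add i₃
  have hH : Complex.I * ∫ t in Set.Ioi (0 : ℝ), e t * jacobiExpr a b (ψ t) n
      = jacobiExpr a b (laplace ψ z) n := by
    simp only [hexpand]
    rw [integral_add i₁₂ i₃, integral_add i₁ i₂, integral_const_mul,
      integral_const_mul, integral_const_mul, jacobiExpr, hψ.laplace_apply ha hz,
      hψ.laplace_apply ha hz, hψ.laplace_apply ha hz]
    ring
  have hder : ∀ t ∈ Set.Ici (0 : ℝ), HasDerivAt (fun t => e t * ψ t n)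
      (Complex.I * z * (e t * ψ t n) - Complex.I * (e t * jacobiExpr a b (ψ t) n)) t :=
    fun t _ => ((hde t).mul (hψ.hasDerivAt_apply n t)).congr_deriv (by ring)
  have hlim : Tendsto (fun t => e t * ψ t n) atTop (𝓝 0) := by
    refine squeeze_zero_norm (a := fun t => Real.exp (-z.im * t)) (fun t => ?_) ?_
    · rw [norm_mul, he, norm_exp_I_mul]
      exact mul_le_of_le_one_right (Real.exp_pos _).le (hψ.norm_apply_le ha n t)
    · refine Real.tendsto_exp_atBot.comp ?_
      exact tendsto_id.const_mul_atTop_of_neg (by linarith)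
  have hftc := integral_Ioi_of_hasDerivAt_of_tendsto' hder
    (((hint n).const_mul _).sub (hHint.const_mul _)) hlim
  rw [integral_sub ((hint n).const_mul _) (hHint.const_mul _), integral_const_mul,
    integral_const_mul, hH, hψ.1] at hftc
  have h0 : e 0 = 1 := by simp [he]
  rw [h0] at hftc
  rw [hψ.laplace_apply ha hz]
  linear_combination -hftc

theorem IsEvolution.laplace_mem_domain (ha : IsJacobiData a)
    (hψ : IsEvolution (jacobiOperator a b) delta1 ψ) {z : ℂ} (hz : 0 < z.im) :
    laplace ψ z ∈ (jacobiOperator a b).domain := by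
  change Memℓp (jacobiExpr a b (laplace ψ z)) 2
  have : jacobiExpr a b (laplace ψ z) = ⇑(delta1 + z • laplace ψ z) := by
    funext n
    rw [hψ.jacobiExpr_laplace ha hz]
    rfl
  rw [this]
  exact lp.memℓp _

/-- The Laplace transform and the vector g supplied by the spectral measure both solve (H - z)x =
δ₁, and H has no non-real eigenvalue. -/
theorem IsEvolution.laplace_one_eq_integral (ha : IsJacobiData a)
    (hψ : IsEvolution (jacobiOperator a b) delta1 ψ) {μ : Measure ℝ}
    (hμ : IsSpectralMeasure (jacobiOperator a b) delta1 μ) {z : ℂ} (hz : 0 < z.im) :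
    laplace ψ z 1 = ∫ x : ℝ, ((x : ℂ) - z)⁻¹ ∂μ := by
  obtain ⟨g, hg, hgμ⟩ := hμ.2 z hz.ne'
  set h : (jacobiOperator a b).domain := ⟨laplace ψ z, hψ.laplace_mem_domain ha hz⟩ with hh
  have hH : jacobiOperator a b h = delta1 + z • laplace ψ z := by
    ext n
    exact hψ.jacobiExpr_laplace ha hz n
  have hzero := eq_zero_of_jacobiOperator_eq_smul ha b hz.ne' (g - h) (by
    rw [LinearPMap.map_sub, hH, sub_eq_iff_eq_add.1 hg, Submodule.coe_sub, smul_sub]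
    abel)
  rw [Submodule.coe_sub, sub_eq_zero] at hzero
  rw [← hgμ, hzero, delta1, lp.inner_single_left]
  simp [hh]

end Evolution

end JacobiDyn

end

/-! ### Lower bound for the resolvent, averaging over energies, and conclusion -/

noncomputable section

namespace JacobiDyn

open MeasureTheory Filter Topology

/-- For energies close to `E`, the box up to the length scales at `E` carries an amount of the
resolvent vector that is controlled from below by the imaginary part of its value at `1`. -/
theorem le_boxNormSq {a b : ℤ → ℝ} (ha : ∀ n, a n ≠ 0) {u : ℤ → ℂ} {z : ℂ}
    (hu : ∀ n, jacobiExpr a b u n = delta1 n + z * u n) {E ε s₁ s₂ L₁ L₂ : ℝ} (hε : 0 < ε)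
    (hz : ‖z - E‖ ^ 2 ≤ 2 * ε ^ 2) (hL₁ : 0 ≤ L₁) (hL₂ : 0 ≤ L₂)
    (hs₁ : s₁ ≤ L₁ + 1) (h₁ : leftGram a b E s₁ = ε⁻¹ ^ 2)
    (hs₂ : s₂ ≤ L₂) (h₂ : rightGram a b E s₂ = ε⁻¹ ^ 2) :
    2 / 15 * ε⁻¹ * |(u 1).im| ≤ boxNormSq u L₁ L₂ := by
  -- Only the values at index 0 are altered: they absorb a(0) and the source δ₁, so that each side
  -- solves the homogeneous equation with the coefficient at index 0 equal to 1.
  set R : ℕ → ℂ := fun n => if n = 0 then a 0 * u 0 - 1 else u n with hR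
  set L : ℕ → ℂ := fun n => if n = 0 then a 0 * u 1 else u (1 - n) with hL
  have hRs : IsSolution (fun n => (rightCoeff a n : ℂ)) (fun n => ((b n : ℝ) : ℂ)) z R := fun n => by
    have h := hu (n + 1)
    rcases n with _ | n
    · simp only [jacobiExpr, delta1_apply] at h
      simp [hR, rightCoeff_zero, rightCoeff_succ] at h ⊢
      linear_combination h
    · simp only [jacobiExpr, delta1_apply] at h
      rw [if_neg (by push_cast; omega)] at h
      simp only [hR, rightCoeff_succ, Nat.succ_ne_zero, if_false]
      push_cast at h ⊢
      rw [add_sub_cancel_right, show (n : ℤ) + 1 + 1 + 1 = n + 1 + 2 by ring] at h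
      linear_combination h
  have hLs : IsSolution (fun n => (leftCoeff a n : ℂ)) (fun n => ((b (1 - n) : ℝ) : ℂ)) z L :=
    fun n => by
    have h := hu (-n)
    rcases n with _ | n
    · simp only [jacobiExpr, delta1_apply] at h
      simp [hL, leftCoeff_zero, leftCoeff_succ] at h ⊢
      linear_combination h
    · simp only [jacobiExpr, delta1_apply] at h
      rw [if_neg (by push_cast; omega)] at h
      simp only [hL, leftCoeff_succ, Nat.succ_ne_zero, if_false]
      push_cast at h ⊢
      rw [show -((n : ℤ) + 1) + 1 = 1 - (n + 1) by ring] at h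
      rw [show 1 - ((n : ℤ) + 1 + 2) = -(n + 1) - 1 by ring,
        show 1 - ((n : ℤ) + 1 + 1) = -(n + 1) by ring,
        show -((n : ℤ) + 1 + 1) = -(n + 1) - 1 by ring]
      linear_combination h
  have kR := partialSum_norm_sq_ge hε (rightCoeff_zero a) (isSolution_rightSol ha b E 0)
    (isSolution_rightSol ha b E (Real.pi / 2)) (rightSol_initial a b E) hRs hz h₂ hs₂
  have kL := partialSum_norm_sq_ge hε (leftCoeff_zero a) (isSolution_leftSol ha b E (Real.pi / 2))
    (isSolution_leftSol ha b E 0) (leftSol_initial a b E) hLs hz h₁ hs₁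
  have eR : ∀ k : ℕ, R (k + 1) = u ((k + 1 : ℕ) : ℤ) := fun k => by simp [hR]
  have eL : ∀ k : ℕ, L (k + 1) = u (1 - ((k + 1 : ℕ) : ℤ)) := fun k => by simp [hL]
  simp only [eR] at kR
  simp only [eL] at kL
  rw [boxNormSq_eq_partialSum _ hL₁ hL₂]
  have him : |(u 1).im| ≤ |((starRingEnd ℂ) (R 0) * R 1).im|
      + |((starRingEnd ℂ) (L 0) * L 1).im| := by
    -- The two terms with a(0) cancel, and only the source contributes.
    have e : -(u 1).im = ((starRingEnd ℂ) (R 0) * R 1).im + ((starRingEnd ℂ) (L 0) * L 1).im := by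
      simp [hR, hL]
      ring
    rw [← abs_neg, e]
    exact abs_add_le _ _
  have hc : 0 ≤ 2 / 15 * ε⁻¹ := by positivity
  have := mul_le_mul_of_nonneg_left him hc
  rw [mul_add] at this
  refine this.trans ?_
  rw [add_comm]
  refine add_le_add ?_ ?_
  · simpa [hL] using kL
  · simpa [hR] using kR

/-- A finite weighted sum commutes with the integrals; the positive weight at site 1 serves the
strict inequality. -/
theorem exists_boxNormSq_eq_sum {L₁ L₂ : ℝ} (hL₁ : 0 ≤ L₁) (hL₂ : 1 ≤ L₂) :
    ∃ (F : Finset ℤ) (w : ℤ → ℝ), (∀ n, 0 ≤ w n) ∧ 1 ∈ F ∧ 0 < w 1 ∧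
      ∀ φ : ℤ → ℂ, boxNormSq φ L₁ L₂ = ∑ n ∈ F, w n * ‖φ n‖ ^ 2 := by
  have h1 : (0 : ℤ) ≤ ⌊L₁⌋ := Int.floor_nonneg.2 hL₁
  have h2 : (1 : ℤ) ≤ ⌊L₂⌋ := Int.le_floor.2 (by exact_mod_cast hL₂)
  have f1 : 0 ≤ L₁ - ⌊L₁⌋ := sub_nonneg.2 (Int.floor_le _)
  have f2 : 0 ≤ L₂ - ⌊L₂⌋ := sub_nonneg.2 (Int.floor_le _)
  refine ⟨insert (-⌊L₁⌋ - 1) (insert (⌊L₂⌋ + 1) (Finset.Icc (-⌊L₁⌋) ⌊L₂⌋)),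
    fun n => if n = -⌊L₁⌋ - 1 then L₁ - ⌊L₁⌋ else if n = ⌊L₂⌋ + 1 then L₂ - ⌊L₂⌋ else 1,
    fun n => ?_, ?_, ?_, fun φ => ?_⟩
  · dsimp only
    split_ifs <;> first | assumption | exact zero_le_one
  · simp only [Finset.mem_insert, Finset.mem_Icc]; omega
  · dsimp only
    rw [if_neg (by omega), if_neg (by omega)]
    exact one_pos
  · rw [Finset.sum_insert (by simp only [Finset.mem_insert, Finset.mem_Icc]; omega),
      Finset.sum_insert (by simp only [Finset.mem_Icc]; omega)]
    dsimp only
    rw [if_pos rfl, if_neg (by omega), if_pos rfl,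
      Finset.sum_congr rfl (g := fun n => ‖φ n‖ ^ 2), boxNormSq]
    · ring
    · intro n hn
      rw [Finset.mem_Icc] at hn
      rw [if_neg (by omega), if_neg (by omega), one_mul]

/-- The average of `μ(ball E ε)` over an `ε`-neighbourhood of `S` controls `μ(S)`. -/
theorem mul_measure_le_lintegral_ball (μ : Measure ℝ) [IsFiniteMeasure μ] (ε : ℝ) (S : Set ℝ) :
    ENNReal.ofReal (2 * ε) * μ S
      ≤ ∫⁻ E in Metric.thickening ε S, μ (Metric.ball E ε) := by
  set A : Set (ℝ × ℝ) := {p | dist p.1 p.2 < ε} with hA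
  have hAm : MeasurableSet A := (isOpen_lt continuous_dist continuous_const).measurableSet
  have e1 : ∀ E, μ (Metric.ball E ε) = ∫⁻ x, A.indicator 1 (E, x) ∂μ := fun E => by
    rw [← lintegral_indicator_one Metric.isOpen_ball.measurableSet]
    refine lintegral_congr fun x => ?_
    simp only [Set.indicator, Metric.mem_ball, hA, Set.mem_ofPred_eq, dist_comm E x]
    rfl
  simp only [e1]
  have hm : Measurable (Function.uncurry fun E x : ℝ =>
      A.indicator (1 : ℝ × ℝ → ENNReal) (E, x)) := measurable_one.indicator hAm
  rw [lintegral_lintegral_swap hm.aemeasurable]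
  calc ENNReal.ofReal (2 * ε) * μ S
      -- Passing to the closure, which has the same ε-thickening, avoids any measurability of S, and
      -- hence of the length scales.
      ≤ ENNReal.ofReal (2 * ε) * μ (closure S) := by gcongr; exact subset_closure
    _ = ∫⁻ _ in closure S, ENNReal.ofReal (2 * ε) ∂μ := by rw [setLIntegral_const]
    _ ≤ ∫⁻ x in closure S, (∫⁻ E in Metric.thickening ε S, A.indicator 1 (E, x)) ∂μ := by
        refine setLIntegral_mono' isClosed_closure.measurableSet fun x hx => ?_
        have hsub : Metric.ball x ε ⊆ Metric.thickening ε S := by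
          rw [← Metric.thickening_closure]
          exact Metric.ball_subset_thickening hx ε
        calc ENNReal.ofReal (2 * ε) = ∫⁻ _ in Metric.ball x ε, 1 := by
              rw [setLIntegral_one, Real.volume_ball]
          _ ≤ ∫⁻ E in Metric.ball x ε, A.indicator 1 (E, x) := by
              refine setLIntegral_mono' Metric.isOpen_ball.measurableSet fun E hE => ?_
              rw [Set.indicator_of_mem (show (E, x) ∈ A from hE)]
              rfl
          _ ≤ _ := lintegral_mono_set hsub
    _ ≤ _ := setLIntegral_le_lintegral _ _

/-- The imaginary part of a Borel transform controls the measure of short intervals. -/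
theorem measureReal_ball_le_im (μ : Measure ℝ) [IsFiniteMeasure μ] {E ε : ℝ} (hε : 0 < ε) :
    (2 * ε)⁻¹ * μ.real (Metric.ball E ε)
      ≤ (∫ x : ℝ, ((x : ℂ) - (E + ε * Complex.I))⁻¹ ∂μ).im := by
  have him : ∀ x : ℝ, (((x : ℂ) - (E + ε * Complex.I))⁻¹).im = ε / ((x - E) ^ 2 + ε ^ 2) :=
    fun x => by
    rw [Complex.inv_im, Complex.normSq_apply]
    simp
    ring
  have hpos : ∀ x : ℝ, 0 < (x - E) ^ 2 + ε ^ 2 := fun x => by positivity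
  have hne : ∀ x : ℝ, (x : ℂ) - (E + ε * Complex.I) ≠ 0 := fun x h => by
    have := congrArg Complex.im h
    simp at this
    exact hε.ne' this
  have hint : Integrable (fun x : ℝ => ((x : ℂ) - (E + ε * Complex.I))⁻¹) μ := by
    refine Integrable.of_bound (C := ε⁻¹)
      (Continuous.aestronglyMeasurable (Continuous.inv₀ (by fun_prop) hne))
      (Eventually.of_forall fun x => ?_)
    rw [norm_inv]
    refine inv_anti₀ hε ?_
    refine le_trans (le_of_eq ?_) (Complex.abs_im_le_norm _)
    simp [abs_of_pos hε]
  have h1 : (∫ x : ℝ, ((x : ℂ) - (E + ε * Complex.I))⁻¹ ∂μ).im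
      = ∫ x : ℝ, ε / ((x - E) ^ 2 + ε ^ 2) ∂μ := by
    have := Complex.imCLM.integral_comp_comm hint
    simp only [Complex.imCLM_apply, him] at this
    exact this.symm
  have hint' : Integrable (fun x : ℝ => ε / ((x - E) ^ 2 + ε ^ 2)) μ := by
    have := Complex.imCLM.integrable_comp hint
    simpa only [Complex.imCLM_apply, him] using this
  rw [h1]
  calc (2 * ε)⁻¹ * μ.real (Metric.ball E ε) = ∫ _ in Metric.ball E ε, (2 * ε)⁻¹ ∂μ := by
        rw [setIntegral_const, smul_eq_mul, mul_comm]
    _ ≤ ∫ x in Metric.ball E ε, ε / ((x - E) ^ 2 + ε ^ 2) ∂μ := by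
        refine setIntegral_mono_on integrableOn_const hint'.integrableOn
          Metric.isOpen_ball.measurableSet fun x hx => ?_
        rw [Metric.mem_ball, Real.dist_eq] at hx
        rw [inv_eq_one_div, div_le_div_iff₀ (by positivity) (hpos x)]
        have : (x - E) ^ 2 ≤ ε ^ 2 := by
          rw [← sq_abs]; exact pow_le_pow_left₀ (abs_nonneg _) hx.le 2
        nlinarith
    _ ≤ _ := setIntegral_le_integral hint' (Eventually.of_forall fun x => by
        have := hpos x
        positivity)

section Evolution

variable {a b : ℤ → ℝ} {ψ : ℝ → ℓ²(ℤ, ℂ)}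

theorem IsEvolution.integrableOn_exp_mul_norm_sq (ha : IsJacobiData a)
    (hψ : IsEvolution (jacobiOperator a b) delta1 ψ) {ε : ℝ} (hε : 0 < ε) (n : ℤ) :
    IntegrableOn (fun t => Real.exp (-2 * ε * t) * ‖ψ t n‖ ^ 2) (Set.Ioi 0) := by
  have hc := hψ.continuous_apply n
  refine Integrable.mono' (exp_neg_integrableOn_Ioi 0 (show 0 < 2 * ε by positivity))
    (Continuous.aestronglyMeasurable (by fun_prop)) (Eventually.of_forall fun t => ?_)
  rw [Real.norm_of_nonneg (by positivity), neg_mul]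
  exact mul_le_of_le_one_right (Real.exp_pos _).le
    (pow_le_one₀ (norm_nonneg _) (hψ.norm_apply_le ha n t))

/-- By continuity ψ(t)(1) stays nonzero for small t, since it equals 1 at t = 0. -/
theorem IsEvolution.integral_exp_mul_norm_sq_one_pos (ha : IsJacobiData a)
    (hψ : IsEvolution (jacobiOperator a b) delta1 ψ) {ε : ℝ} (hε : 0 < ε) :
    0 < ∫ t in Set.Ioi (0 : ℝ), Real.exp (-2 * ε * t) * ‖ψ t 1‖ ^ 2 := by
  rw [setIntegral_pos_iff_support_of_nonneg_ae (Eventually.of_forall fun t => by positivity)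
    (hψ.integrableOn_exp_mul_norm_sq ha hε 1)]
  have h0 : ψ 0 1 ≠ 0 := by rw [hψ.1, delta1_apply]; simp
  obtain ⟨δ, hδ, hball⟩ := Metric.eventually_nhds_iff.1
    ((hψ.continuous_apply 1).continuousAt.eventually_ne h0)
  refine lt_of_lt_of_le ?_ (measure_mono (show Set.Ioo 0 δ ⊆ _ from fun t ht => ⟨?_, ht.1⟩))
  · simpa using hδ
  · have := hball (show dist t 0 < δ by
      rw [Real.dist_eq, sub_zero, abs_of_pos ht.1]; exact ht.2)
    have h' : 0 < ‖ψ t 1‖ := norm_pos_iff.2 this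
    rw [Function.mem_support]
    positivity

/-- The time average of the box norm is an energy average of the box norm of the resolvent. -/
theorem IsEvolution.integral_boxNormSq_laplace (ha : IsJacobiData a)
    (hψ : IsEvolution (jacobiOperator a b) delta1 ψ) {T L₁ L₂ : ℝ} (hT : 0 < T)
    (hL₁ : 0 ≤ L₁) (hL₂ : 1 ≤ L₂) :
    Integrable (fun E : ℝ => boxNormSq (laplace ψ (E + (T⁻¹ : ℝ) * Complex.I)) L₁ L₂) ∧
    ∫ E : ℝ, boxNormSq (laplace ψ (E + (T⁻¹ : ℝ) * Complex.I)) L₁ L₂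
      = Real.pi * T * timeAverage T (fun t => boxNormSq (ψ t) L₁ L₂) ∧
    0 < timeAverage T (fun t => boxNormSq (ψ t) L₁ L₂) := by
  have hε : 0 < T⁻¹ := inv_pos.2 hT
  obtain ⟨F, w, hw, h1F, hw1, hbox⟩ := exists_boxNormSq_eq_sum hL₁ hL₂
  have hlap : ∀ (n : ℤ) (E : ℝ), ‖laplace ψ (E + (T⁻¹ : ℝ) * Complex.I) n‖ ^ 2
      = ‖∫ t in Set.Ioi (0 : ℝ),
        Complex.exp (Complex.I * (E + (T⁻¹ : ℝ) * Complex.I) * t) * ψ t n‖ ^ 2 := fun n E => by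
    rw [hψ.laplace_apply ha (by simpa using hT), norm_mul, Complex.norm_I, one_mul]
  have hpl := fun n : ℤ =>
    integral_norm_laplace_sq hε (hψ.continuous_apply n) (hψ.norm_apply_le ha n)
  have hint := hψ.integrableOn_exp_mul_norm_sq ha hε
  have hexp : ∀ t : ℝ, -2 * t / T = -2 * T⁻¹ * t := fun t => by
    rw [div_eq_mul_inv]; ring
  have hta : timeAverage T (fun t => boxNormSq (ψ t) L₁ L₂)
      = 2 / T * ∑ n ∈ F, w n * ∫ t in Set.Ioi (0 : ℝ),
        Real.exp (-2 * T⁻¹ * t) * ‖ψ t n‖ ^ 2 := by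
    simp only [timeAverage, hbox, hexp, Finset.mul_sum, mul_left_comm _ (w _)]
    rw [integral_finsetSum _ fun n _ => (hint n).const_mul _]
    simp only [integral_const_mul, Finset.mul_sum, mul_left_comm _ (w _)]
  simp only [hbox, hlap]
  refine ⟨integrable_finsetSum _ fun n _ => (hpl n).1.const_mul _, ?_, ?_⟩
  · simp only [hbox] at hta
    rw [integral_finsetSum _ fun n _ => (hpl n).1.const_mul _, hta]
    simp only [integral_const_mul, (hpl _).2, Finset.mul_sum]
    refine Finset.sum_congr rfl fun n _ => ?_
    field_simp
  · simp only [hbox] at hta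
    rw [hta]
    refine mul_pos (by positivity) (Finset.sum_pos' (fun n _ => mul_nonneg (hw n) ?_)
      ⟨1, h1F, mul_pos hw1 (hψ.integral_exp_mul_norm_sq_one_pos ha hε)⟩)
    exact integral_nonneg fun t => by positivity

theorem IsEvolution.mul_measureReal_lt_timeAverage (ha : IsJacobiData a)
    (hψ : IsEvolution (jacobiOperator a b) delta1 ψ) {μ : Measure ℝ}
    (hμ : IsSpectralMeasure (jacobiOperator a b) delta1 μ) {T L₁ L₂ : ℝ} (hT : 0 < T)
    (hL₁ : 0 ≤ L₁) (hL₂ : 1 ≤ L₂) {S : Set ℝ}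
    (hS : ∀ E ∈ S, (∃ s ≤ L₁ + 1, leftGram a b E s = (T⁻¹)⁻¹ ^ 2) ∧
      ∃ s ≤ L₂, rightGram a b E s = (T⁻¹)⁻¹ ^ 2) :
    (15 * Real.pi)⁻¹ * μ.real S < timeAverage T (fun t => boxNormSq (ψ t) L₁ L₂) := by
  have := hμ.1
  obtain ⟨hint, hval, hpos⟩ := hψ.integral_boxNormSq_laplace ha hT hL₁ hL₂
  set ε := T⁻¹ with hεT
  have hε : 0 < ε := inv_pos.2 hT
  set N : ℝ → ℝ := fun E => boxNormSq (laplace ψ (E + ε * Complex.I)) L₁ L₂ with hN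
  have hN0 : ∀ E, 0 ≤ N E := fun E => by
    rw [hN]
    dsimp only
    rw [boxNormSq_eq_partialSum _ hL₁ (by linarith)]
    exact add_nonneg (partialSum_nonneg _ fun k => sq_nonneg _)
      (partialSum_nonneg _ fun k => sq_nonneg _)
  have hball : ∀ E ∈ Metric.thickening ε S,
      μ (Metric.ball E ε) ≤ ENNReal.ofReal (15 * ε ^ 2 * N E) := fun E hE => by
    obtain ⟨E', hE', hd⟩ := Metric.mem_thickening_iff.1 hE
    obtain ⟨⟨s₁, hs₁, h₁⟩, s₂, hs₂, h₂⟩ := hS E' hE'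
    have hzim : ((E : ℂ) + ε * Complex.I).im = ε := by simp
    -- The real and the imaginary part of the difference are each at most ε in absolute value.
    have hz : ‖(E : ℂ) + ε * Complex.I - E'‖ ^ 2 ≤ 2 * ε ^ 2 := by
      rw [← Complex.normSq_eq_norm_sq, Complex.normSq_apply]
      rw [Real.dist_eq] at hd
      have : (E - E') ^ 2 ≤ ε ^ 2 := by
        rw [← sq_abs]; exact pow_le_pow_left₀ (abs_nonneg _) hd.le 2
      simp
      nlinarith
    have k1 := le_boxNormSq ha.ne_zero
      (hψ.jacobiExpr_laplace ha (z := E + ε * Complex.I) (by rwa [hzim])) hε hz hL₁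
      (by linarith) hs₁ h₁ hs₂ h₂
    have k2 := measureReal_ball_le_im μ (E := E) hε
    rw [← hψ.laplace_one_eq_integral ha hμ (by rwa [hzim])] at k2
    rw [← ofReal_measureReal]
    refine ENNReal.ofReal_le_ofReal ?_
    have k3 : 2 / 15 * ε⁻¹ * ((2 * ε)⁻¹ * μ.real (Metric.ball E ε)) ≤ N E :=
      le_trans (mul_le_mul_of_nonneg_left (k2.trans (le_abs_self _)) (by positivity)) k1
    calc μ.real (Metric.ball E ε)
        = 15 * ε ^ 2 * (2 / 15 * ε⁻¹ * ((2 * ε)⁻¹ * μ.real (Metric.ball E ε))) := by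
          field_simp
      _ ≤ _ := by gcongr
  -- Integrating the bound over the thickening gives 2ε μ(S) ≤ 15ε² ∫ N, where ∫ N is πT times the
  -- time average.
  have key : ENNReal.ofReal (2 * ε) * μ S ≤ ENNReal.ofReal (15 * ε ^ 2 * ∫ E, N E) := by
    refine (mul_measure_le_lintegral_ball μ ε S).trans ?_
    refine (setLIntegral_mono' Metric.isOpen_thickening.measurableSet hball).trans ?_
    refine (setLIntegral_le_lintegral _ _).trans (le_of_eq ?_)
    rw [← integral_const_mul, ofReal_integral_eq_lintegral_ofReal (hint.const_mul _)
      (Eventually.of_forall fun E => mul_nonneg (by positivity) (hN0 E))]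
  rw [← ofReal_measureReal, ← ENNReal.ofReal_mul (by positivity),
    ENNReal.ofReal_le_ofReal_iff (mul_nonneg (by positivity) (integral_nonneg hN0)), hval] at key
  have hεT1 : ε * T = 1 := inv_mul_cancel₀ hT.ne'
  set A := timeAverage T (fun t => boxNormSq (ψ t) L₁ L₂)
  have hpi := Real.pi_pos
  have k : ε * (2 * μ.real S) ≤ ε * (15 * Real.pi * A) := by
    calc ε * (2 * μ.real S) = 2 * ε * μ.real S := by ring
      _ ≤ _ := key
      _ = ε * (15 * Real.pi * A) := by linear_combination (15 * ε * Real.pi * A) * hεT1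
  have k' := le_of_mul_le_mul_left k hε
  rw [inv_mul_lt_iff₀ (by positivity)]
  -- The argument yields the constant 2/(15π); halving it and using A > 0 makes the inequality
  -- strict.
  have : 0 < 15 * Real.pi * A := by positivity
  linarith

end Evolution

end JacobiDyn
end

theorem theorem1p5 :
    ∃ C : ℝ, 0 < C ∧
      ∀ (a b : ℤ → ℝ), JacobiDyn.IsJacobiData a →
      ∀ (ψ : ℝ → lp (fun _ : ℤ => ℂ) 2),
        JacobiDyn.IsEvolution (JacobiDyn.jacobiOperator a b) JacobiDyn.delta1 ψ →
      ∀ (μ : MeasureTheory.Measure ℝ),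
        JacobiDyn.IsSpectralMeasure (JacobiDyn.jacobiOperator a b) JacobiDyn.delta1 μ →
      ∀ (T L₁ L₂ : ℝ), 0 < T → 1 < L₁ → 1 < L₂ →
        (C * μ.real {E : ℝ | JacobiDyn.scaleLeft a b T⁻¹ E ≤ L₁ ∧
              JacobiDyn.scaleRight a b T⁻¹ E ≤ L₂}
            < JacobiDyn.timeAverage T (fun t => JacobiDyn.boxNormSq (ψ t) L₁ L₂)) ∧
        (2 < L₁ → 2 < L₂ →
          C * μ.real {E : ℝ | JacobiDyn.transferScaleLeft a b T⁻¹ E ≤ L₁ ∧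
              JacobiDyn.transferScaleRight a b T⁻¹ E ≤ L₂}
            < JacobiDyn.timeAverage T (fun t => JacobiDyn.boxNormSq (ψ t) L₁ L₂)) := by
  refine ⟨(15 * Real.pi)⁻¹, by have := Real.pi_pos; positivity, ?_⟩
  intro a b ha ψ hψ μ hμ T L₁ L₂ hT hL₁ hL₂
  have hε : 0 < T⁻¹ := inv_pos.2 hT
  refine ⟨?_, fun h₁ h₂ => ?_⟩
  · exact hψ.mul_measureReal_lt_timeAverage ha hμ hT (by linarith) hL₂.le fun E hE =>
      ⟨JacobiDyn.exists_leftGram_eq ha b hε hE.1, JacobiDyn.exists_rightGram_eq ha b hε hE.2⟩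
  · exact hψ.mul_measureReal_lt_timeAverage ha hμ hT (by linarith) hL₂.le fun E hE =>
      ⟨JacobiDyn.exists_leftGram_eq_of_transfer ha b hε hE.1 h₁,
        JacobiDyn.exists_rightGram_eq_of_transfer ha b hε hE.2 h₂⟩
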